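/- Let $\mathcal A$ be a non-empty finite or countable alphabet with the discrete topology, let $X=\mathcal A^{\mathbb N}$ carry the product topology and its Borel $\sigma$-field, and let $T:X\to X$, $T(x_1,x_2,\dots)=(x_2,x_3,\dots)$. Let $g(x)=g_0\prod_{n\ge 1}g_n(x_n)$ be a potential of product type, with a constant $g_0>0$ and functions $g_n:\mathcal A\to(0,\infty)$. Assume that $g$ is $\ell_1$-bounded, $\sum_{k\ge 2}\|\log g_k\|_\infty<\infty$, and summable, $\sum_{a\in\mathcal A}g_1(a)<\infty$. For $f:X\to\mathbb R$ let $\mathcal L_f\varphi(x)=\sum_{Ty=x}\varphi(y)e^{f(y)}$, and let $\mathcal L_f^*m$ be given by $\int\varphi\,d\mathcal L_f^*m=\int\mathcal L_f\varphi\,dm$ for bounded continuous $\varphi$. Put $$P(f)=\lim_{n\to\infty}\frac1n\log\sum_{w\in\mathcal A^n}\ \sup_{x\in[w]}\ \exp\Big(\sum_{i=0}^{n-1}f(T^ix)\Big),$$ where $[w]$ is the set of sequences that begin with the word $w$, and let $h_m(T)\in[0,\infty]$ be the Kolmogorov–Sinai entropy of a $T$-invariant probability measure $m$. Let $$\lambda=g_0\sum_{a\in\mathcal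 A}\prod_{k=1}^\infty g_k(a),\qquad \tilde g(x)=\frac{\prod_{i=1}^\infty g_i(x_1)}{\sum_{a\in\mathcal A}\prod_{i=1}^\infty g_i(a)},$$ let $\mu=\bigotimes_{n\ge1}\mu_n$ be the product measure, and $\tilde\mu$ the Bernoulli measure with weights $\tilde\mu_0(a)$, where $$\mu_n(a)=\frac{\prod_{i=1}^n g_i(a)}{\sum_{b\in\mathcal A}\prod_{i=1}^n g_i(b)},\qquad \tilde\mu_0(a)=\frac{\prod_{i=1}^\infty g_i(a)}{\sum_{b\in\mathcal A}\prod_{i=1}^\infty g_i(b)}.$$ 1. $\mu$ and $\tilde\mu$ are probability measures, $\tilde\mu$ is $T$-invariant, $\mathcal L_{\log g}^*\mu=\lambda\mu$, $\mathcal L_{\log\tilde g}^*\tilde\mu=\tilde\mu$, and the limit $P(\log g)$ exists and equals $\log\lambda$, with $0<\lambda<\infty$. Moreover $\int\log g\,d\tilde\mu$ exists in $[-\infty,\infty)$ and $h_{\tilde\mu}(T)=P(\log g)-\int\log g\,d\tilde\mu$ in $[0,\infty]$; in particular, if $h_{\tilde\mu}(T)<\infty$, then $\log g$ is $\tilde\mu$-integrable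 and $$P(\log g)=h_{\tilde\mu}(T)+\int\log g\,d\tilde\mu .$$ If $\mathcal A$ is finite, then $h_{\tilde\mu}(T)<\infty$ and $\tilde\mu$ is an equilibrium state, that is, it realizes the supremum of $h_m(T)+\int\log g\,dm$ over all $T$-invariant Borel probability measures $m$. 2. Suppose that $\mathcal A$ is finite, that $g$ is in balanced form, $\prod_{a\in\mathcal A}g_n(a)=1$ for all $n\ge1$, and that $g$ has $\ell_2$-bounded tails, i.e. $\sum_{i\ge k}\sup_{a\in\mathcal A}\big(\sum_{j\ge i}\log g_j(a)\big)^2<\infty$ for some $k$. Let $h_i(a)=\prod_{k>i}g_k(a)$. Then $h(x)=\prod_{i=1}^\infty h_i(x_i)=\lim_{N\to\infty}\prod_{i=1}^N h_i(x_i)$ exists in $(0,\infty)$ for almost every $x\in X$ with respect to the $(1/|\mathcal A|,\dots,1/|\mathcal A|)$-Bernoulli measure. Furthermore $\mathcal L_{\log g}h=\lambda h$: whenever $h(x)$ exists, $h(y)$ exists for every $y$ with $Ty=x$, and $\mathcal L_{\log g}h(x)=\lambda h(x)$. -/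

import Mathlib

open MeasureTheory Filter Topology
open scoped ENNReal

noncomputable section

namespace ProductType

/-! ### The one-sided full shift -/

/-- The one-sided full shift `A^ℕ`; the coordinate with index `n` here is the `(n+1)`-st letter. -/
abbrev Seq (A : Type*) : Type _ := ℕ → A

/-- The shift map `(x₁, x₂, …) ↦ (x₂, x₃, …)`. -/
def shift {A : Type*} (x : Seq A) : Seq A := fun n => x (n + 1)

/-- The cylinder set of a word of length `n`. -/
def cylinder {A : Type*} {n : ℕ} (w : Fin n → A) : Set (Seq A) :=
  {x | ∀ i : Fin n, x i = w i}

/-! ### Ruelle operator, its dual, and pressure -/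

/-- The Ruelle operator `(L_f φ)(x) = ∑_{T y = x} φ(y) exp (f y)`. -/
def ruelle {A : Type*} (f φ : Seq A → ℝ) (x : Seq A) : ℝ :=
  ∑' y : {y : Seq A // shift y = x}, φ y * Real.exp (f y)

/-- `ν = L_f^* m`: for every bounded continuous `φ` the function `L_f φ` is well defined
everywhere, is `m`-integrable, and `∫ L_f φ dm = ∫ φ dν`. -/
def IsDualImage {A : Type*} [TopologicalSpace A] [MeasurableSpace A]
    (f : Seq A → ℝ) (m ν : Measure (Seq A)) : Prop :=
  ∀ φ : BoundedContinuousFunction (Seq A) ℝ,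
    (∀ x : Seq A, Summable fun y : {y : Seq A // shift y = x} => φ y * Real.exp (f y)) ∧
    Integrable (ruelle f φ) m ∧
    ∫ x, ruelle f φ x ∂m = ∫ x, φ x ∂ν

/-- The partition function `∑_{w ∈ A^n} sup_{x ∈ [w]} exp (f x + f (T x) + ⋯ + f (T^{n-1} x))`. -/
def partitionFunction {A : Type*} (f : Seq A → ℝ) (n : ℕ) : ℝ≥0∞ :=
  ∑' w : Fin n → A, ⨆ x ∈ cylinder w,
    ENNReal.ofReal (∏ i ∈ Finset.range n, Real.exp (f (shift^[i] x)))

/-- The pressure of `f` exists as a limit and equals `P`. -/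
def HasPressure {A : Type*} (f : Seq A → ℝ) (P : EReal) : Prop :=
  Tendsto (fun n : ℕ => ENNReal.log (partitionFunction f n) / (n : EReal)) atTop (𝓝 P)

/-! ### Kolmogorov–Sinai entropy and equilibrium states -/

/-- The Shannon entropy `H_m(ξ ∨ T⁻¹ξ ∨ ⋯ ∨ T^{-(n-1)}ξ)` of the `n`-th refinement of a finite
partition, which is given by its labelling map `ξ : X → {0, …, k-1}`. -/
def refinedEntropy {X : Type*} [MeasurableSpace X] (m : Measure X) (T : X → X) {k : ℕ}
    (ξ : X → Fin k) (n : ℕ) : ℝ :=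
  ∑ w : Fin n → Fin k, Real.negMulLog (m.real {x | ∀ i : Fin n, ξ (T^[i] x) = w i})

/-- The Kolmogorov–Sinai entropy: the supremum of `lim (1/n) H_m(⋁_{i<n} T^{-i}ξ)` over all
finite measurable partitions `ξ` (for invariant `m` the limit exists by subadditivity). -/
def ksEntropy {X : Type*} [MeasurableSpace X] (m : Measure X) (T : X → X) : EReal :=
  ⨆ (k : ℕ) (ξ : X → Fin k) (_ : Measurable ξ),
    limsup (fun n : ℕ => ((refinedEntropy m T ξ n / n : ℝ) : EReal)) atTop

/-- The `T`-invariant Borel probability measures on the full shift. -/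
def invariantMeasures (A : Type*) [MeasurableSpace A] : Set (Measure (Seq A)) :=
  {m | IsProbabilityMeasure m ∧ MeasurePreserving shift m m}

/-- `m` is an equilibrium state of `f`: it is an invariant probability measure, and it realizes
the supremum of `h_{m'}(T) + ∫ f dm'` over all invariant probability measures `m'`. -/
def IsEquilibriumState {A : Type*} [MeasurableSpace A] (f : Seq A → ℝ)
    (m : Measure (Seq A)) : Prop :=
  m ∈ invariantMeasures A ∧
    IsGreatest
      ((fun m' : Measure (Seq A) => ksEntropy m' shift + ((∫ x, f x ∂m' : ℝ) : EReal)) ''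
        invariantMeasures A)
      (ksEntropy m shift + ((∫ x, f x ∂m : ℝ) : EReal))

/-- The extended integral `∫ f⁺ dm - ∫ f⁻ dm`, meaningful when one of the two is finite. -/
def extIntegral {X : Type*} [MeasurableSpace X] (m : Measure X) (f : X → ℝ) : EReal :=
  ((∫⁻ x, ENNReal.ofReal (f x) ∂m : ℝ≥0∞) : EReal) -
    ((∫⁻ x, ENNReal.ofReal (-f x) ∂m : ℝ≥0∞) : EReal)

/-! ### Measures of product type -/

/-- The measure on the alphabet that gives mass `p a` to the letter `a`. -/
def letterMeasure {A : Type*} [MeasurableSpace A] (p : A → ℝ) : Measure A :=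
  Measure.sum fun a => ENNReal.ofReal (p a) • Measure.dirac a

/-- The product measure whose `n`-th factor has the weights `p n`. -/
def productMeasure {A : Type*} [MeasurableSpace A] (p : ℕ → A → ℝ) : Measure (Seq A) :=
  Measure.infinitePi fun n => letterMeasure (p n)

/-! ### Potentials of product type -/

/-- The data of `g(x) = g₀ ∏_{n ≥ 1} g_n(x_n)` with `g₀ > 0` and `g_n > 0`;
`factor n` is `g_{n+1}`. -/
structure Potential (A : Type*) where
  const : ℝ
  const_pos : 0 < const
  factor : ℕ → A → ℝ
  factor_pos : ∀ n a, 0 < factor n a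

namespace Potential

variable {A : Type*} (g : Potential A)

/-- The function `g(x) = g₀ ∏_{n ≥ 1} g_n(x_n)`. -/
def eval (x : Seq A) : ℝ := g.const * ∏' n, g.factor n (x n)

/-- The function `log g`. -/
def logEval (x : Seq A) : ℝ := Real.log (g.eval x)

/-- `ℓ₁`-boundedness: `∑_{k ≥ 2} ‖log g_k‖_∞ < ∞`. -/
def L1Bounded : Prop := ∑' k : ℕ, ⨆ a : A, ‖Real.log (g.factor (k + 1) a)‖ₑ < ∞

/-- Summability: `∑_a g₁(a) < ∞`. -/
def IsSummable : Prop := Summable (g.factor 0)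

/-- `ℓ₂`-bounded tails: `∑_{i ≥ k} sup_a (∑_{j ≥ i} log g_j(a))² < ∞` for some `k`. -/
def L2BoundedTails : Prop :=
  ∃ k : ℕ, ∑' i : ℕ, ⨆ a : A,
    ENNReal.ofReal ((∑' j : ℕ, Real.log (g.factor (k + i + j) a)) ^ 2) < ∞

/-- Balanced form over a finite alphabet: `∏_a g_n(a) = 1` for all `n ≥ 1`. -/
def Balanced [Fintype A] : Prop := ∀ n, ∏ a, g.factor n a = 1

/-- `∏_{i=1}^∞ g_i(a)`. -/
def diag (a : A) : ℝ := ∏' i, g.factor i a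

/-- `λ = g₀ ∑_a ∏_{k=1}^∞ g_k(a)`. -/
def eigenvalue : ℝ := g.const * ∑' a, g.diag a

/-- The weights `μ_n(a)`, proportional to `∏_{i=1}^n g_i(a)`; `conformalWeight n` is `μ_{n+1}`. -/
def conformalWeight (n : ℕ) (a : A) : ℝ :=
  (∏ i ∈ Finset.range (n + 1), g.factor i a) / ∑' b, ∏ i ∈ Finset.range (n + 1), g.factor i b

/-- The weights `μ̃₀(a)`, proportional to `∏_{i=1}^∞ g_i(a)`. -/
def bernoulliWeight (a : A) : ℝ := g.diag a / ∑' b, g.diag b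

/-- The product measure `μ = ⊗ μ_n`. -/
def conformalMeasure [MeasurableSpace A] : Measure (Seq A) := productMeasure g.conformalWeight

/-- The Bernoulli measure `μ̃` with weights `μ̃₀`. -/
def bernoulliMeasure [MeasurableSpace A] : Measure (Seq A) :=
  productMeasure fun _ => g.bernoulliWeight

/-- The logarithm of `g̃(x) = ∏_i g_i(x₁) / ∑_a ∏_i g_i(a)`. -/
def logNormalized (x : Seq A) : ℝ := Real.log (g.diag (x 0) / ∑' a, g.diag a)

/-- `h_i(a) = ∏_{k > i} g_k(a)`; `eigenFactor i` is `h_{i+1}`. -/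
def eigenFactor (i : ℕ) (a : A) : ℝ := ∏' k, g.factor (i + 1 + k) a

/-- The product `h(x) = ∏_{i ≥ 1} h_i(x_i)` converges (possibly only conditionally) to the
value `c`, which, as for every convergent infinite product, has to be non-zero, so positive. -/
def EigenfunctionHasValue (x : Seq A) (c : ℝ) : Prop :=
  0 < c ∧ Tendsto (fun N : ℕ => ∏ i ∈ Finset.range N, g.eigenFactor i (x i)) atTop (𝓝 c)

/-- `h(x)` exists. -/
def EigenfunctionExistsAt (x : Seq A) : Prop := ∃ c, g.EigenfunctionHasValue x c

/-- The function `h`, the limit of the partial products wherever it exists. -/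
def eigenfunction (x : Seq A) : ℝ :=
  limUnder atTop fun N : ℕ => ∏ i ∈ Finset.range N, g.eigenFactor i (x i)

end Potential

/-- The `(1/|A|, …, 1/|A|)`-Bernoulli measure. -/
def uniformBernoulli (A : Type*) [Fintype A] [MeasurableSpace A] : Measure (Seq A) :=
  productMeasure fun _ _ => 1 / (Fintype.card A : ℝ)

end ProductType

end

/-! Number the factors as in the statement, and let Z_n = ∑_a g_1(a)⋯g_n(a), so that μ_n = g_1⋯g_n /
Z_n. By ℓ₁-boundedness, cutting off all factors after the n-th changes g, and every diagonal product
∏ g_i(a), only by a factor e^r with |r| bounded by a tail that tends to 0 uniformly in the point.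
Hence Z_n → ∑_a ∏ g_i(a) and g_0 Z_n → λ.

Conformality rests on g_{i+1} μ_i = (Z_{i+1}/Z_i) μ_{i+1}. The ratios telescope to g_1(w_1)⋯g_n(w_n)
μ[w_2…w_n] = Z_n μ[w] (`prod_factor_mul_prod_conformalWeight`), so the dual operator multiplies the
mass of an n-cylinder by g_0 Z_n, up to the tail error. Such estimates pass to shorter cylinders by
summation, and n → ∞ gives the factor λ exactly (`dualMeasure_conformalMeasure`). The normalized
potential is a special case. In the same way the Birkhoff product g(x)⋯g(T^{n-1}x) is ∏_{m≤n} g_0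
Z_m times the μ-mass of the n-cylinder of x, up to the sum of n tails; the masses add up to 1, and
Cesàro means give the pressure.

For the entropy, log g equals log λ + log μ̃₀(x_1) plus a bounded function whose integral vanishes
for every invariant measure (`logEval_eq_add_coboundary`, `integral_coboundary`). By `ksEntropy_le`,
the entropy of an invariant measure is at most its cross entropy with μ̃; over a finite alphabet
this is the variational inequality. For μ̃ itself, partitions by finitely many letters give the
reverse bound, including the case of infinite entropy.

For the eigenfunction, the variables log h_i(x_i) are independent under the uniform measure, centred
because of the balanced form, and have summable variances because of the ℓ₂ tails, so martingale
convergence applies. The eigenvalue equation follows from h_i = g_{i+1} h_{i+1}, which relates h(ax)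
to h(x) (`EigenfunctionHasValue.cons`). -/

noncomputable section

namespace ProductType

/-! ### Convergence of the infinite products -/

namespace Potential

variable {A : Type*} {g : Potential A}

/-- The uniform bound `‖log g_{k+2}‖_∞` of the logarithm of a factor. -/
def logBound (g : Potential A) (k : ℕ) : ℝ :=
  (⨆ a : A, ‖Real.log (g.factor (k + 1) a)‖ₑ).toReal

/-- The tails of the series of the uniform bounds. -/
def tailBound (g : Potential A) (n : ℕ) : ℝ := ∑' k, g.logBound (n + k)

/-- The finite products `∏_{i ≤ n} g_i(a)`. -/
def partialDiag (g : Potential A) (n : ℕ) (a : A) : ℝ := ∏ i ∈ Finset.range (n + 1), g.factor i a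

/-- The normalization of the `n`-th conformal weight. -/
def partialTotal (g : Potential A) (n : ℕ) : ℝ := ∑' b, g.partialDiag n b

lemma summable_logBound (hg : g.L1Bounded) : Summable g.logBound :=
  ENNReal.summable_toReal hg.ne

lemma abs_log_le_logBound (hg : g.L1Bounded) (k : ℕ) (a : A) :
    |Real.log (g.factor (k + 1) a)| ≤ g.logBound k := by
  have hfin : (⨆ a : A, ‖Real.log (g.factor (k + 1) a)‖ₑ) ≠ ∞ :=
    ENNReal.ne_top_of_tsum_ne_top hg.ne k
  have h := ENNReal.toReal_mono hfin
    (le_iSup (fun a : A => ‖Real.log (g.factor (k + 1) a)‖ₑ) a)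
  simpa [logBound] using h

lemma summable_logBound_add (hg : g.L1Bounded) (n : ℕ) :
    Summable fun k => g.logBound (n + k) :=
  (summable_logBound hg).comp_injective (add_right_injective n)

lemma tendsto_tailBound : Tendsto g.tailBound atTop (𝓝 0) := by
  have h := tendsto_sum_nat_add g.logBound
  refine h.congr fun n => ?_
  simp only [tailBound, add_comm]

lemma summable_log_tail (hg : g.L1Bounded) (n : ℕ) (x : ℕ → A) :
    Summable fun k => Real.log (g.factor (n + k + 1) (x k)) :=
  .of_norm_bounded (summable_logBound_add hg n) fun k => abs_log_le_logBound hg (n + k) (x k)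

lemma abs_tsum_log_tail_le (hg : g.L1Bounded) (n : ℕ) (x : ℕ → A) :
    |∑' k, Real.log (g.factor (n + k + 1) (x k))| ≤ g.tailBound n := by
  rw [← Real.norm_eq_abs]
  exact tsum_of_norm_bounded (summable_logBound_add hg n).hasSum
    fun k => abs_log_le_logBound hg (n + k) (x k)

lemma summable_log (hg : g.L1Bounded) (x : Seq A) :
    Summable fun n => Real.log (g.factor n (x n)) := by
  rw [← summable_nat_add_iff 1]
  simpa using summable_log_tail hg 0 (fun k => x (k + 1))

lemma tsum_log_eq (hg : g.L1Bounded) (n : ℕ) (x : Seq A) :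
    ∑' k, Real.log (g.factor k (x k)) = ∑ k ∈ Finset.range (n + 1), Real.log (g.factor k (x k)) +
      ∑' k, Real.log (g.factor (n + k + 1) (x (n + k + 1))) := by
  rw [← (summable_log hg x).sum_add_tsum_nat_add (n + 1)]
  congr 2 with k
  rw [show k + (n + 1) = n + k + 1 by ring]

lemma eval_eq (hg : g.L1Bounded) (x : Seq A) :
    g.eval x = g.const * Real.exp (∑' n, Real.log (g.factor n (x n))) := by
  rw [eval, Real.rexp_tsum_eq_tprod (fun n => g.factor_pos n _) (summable_log hg x)]

lemma eval_pos (hg : g.L1Bounded) (x : Seq A) : 0 < g.eval x := by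
  rw [eval_eq hg]; exact mul_pos g.const_pos (Real.exp_pos _)

lemma logEval_eq (hg : g.L1Bounded) (x : Seq A) :
    g.logEval x = Real.log g.const + ∑' n, Real.log (g.factor n (x n)) := by
  rw [logEval, eval_eq hg, Real.log_mul g.const_pos.ne' (Real.exp_ne_zero _), Real.log_exp]

lemma exp_logEval (hg : g.L1Bounded) (x : Seq A) : Real.exp (g.logEval x) = g.eval x :=
  Real.exp_log (eval_pos hg x)

lemma diag_eq (hg : g.L1Bounded) (a : A) :
    g.diag a = Real.exp (∑' n, Real.log (g.factor n a)) := by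
  rw [diag, Real.rexp_tsum_eq_tprod (fun n => g.factor_pos n _) (summable_log hg fun _ => a)]

lemma diag_pos (hg : g.L1Bounded) (a : A) : 0 < g.diag a := by
  rw [diag_eq hg]; exact Real.exp_pos _

lemma eigenFactor_eq (hg : g.L1Bounded) (i : ℕ) (a : A) :
    g.eigenFactor i a = Real.exp (∑' k, Real.log (g.factor (i + 1 + k) a)) := by
  rw [eigenFactor, Real.rexp_tsum_eq_tprod (fun n => g.factor_pos _ _)]
  refine (summable_log_tail hg i fun _ => a).congr fun k => ?_
  rw [show i + 1 + k = i + k + 1 by ring]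

lemma eigenFactor_pos (hg : g.L1Bounded) (i : ℕ) (a : A) : 0 < g.eigenFactor i a := by
  rw [eigenFactor_eq hg]; exact Real.exp_pos _

lemma partialDiag_pos (n : ℕ) (a : A) : 0 < g.partialDiag n a :=
  Finset.prod_pos fun i _ => g.factor_pos i a

lemma partialDiag_succ (n : ℕ) (a : A) :
    g.partialDiag (n + 1) a = g.partialDiag n a * g.factor (n + 1) a :=
  Finset.prod_range_succ _ _

lemma exp_sum_log (n : ℕ) (x : Seq A) :
    Real.exp (∑ k ∈ Finset.range n, Real.log (g.factor k (x k))) =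
      ∏ k ∈ Finset.range n, g.factor k (x k) := by
  rw [Real.exp_sum]
  exact Finset.prod_congr rfl fun k _ => Real.exp_log (g.factor_pos _ _)

/-- The value of `g` at `x` is determined by the first letters up to a small relative error. -/
lemma exists_eval_eq (hg : g.L1Bounded) (n : ℕ) (x : Seq A) :
    ∃ r, |r| ≤ g.tailBound n ∧
      g.eval x = g.const * (∏ k ∈ Finset.range (n + 1), g.factor k (x k)) * Real.exp r := by
  refine ⟨_, abs_tsum_log_tail_le hg n (fun k => x (n + k + 1)), ?_⟩
  rw [eval_eq hg, tsum_log_eq hg n, Real.exp_add, exp_sum_log, mul_assoc]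

lemma exists_diag_eq (hg : g.L1Bounded) (n : ℕ) (a : A) :
    ∃ r, |r| ≤ g.tailBound n ∧ g.diag a = g.partialDiag n a * Real.exp r := by
  refine ⟨_, abs_tsum_log_tail_le hg n (fun _ => a), ?_⟩
  rw [diag_eq hg, tsum_log_eq hg n (fun _ => a), Real.exp_add, exp_sum_log, partialDiag]

lemma diag_le (hg : g.L1Bounded) (n : ℕ) (a : A) :
    g.diag a ≤ g.partialDiag n a * Real.exp (g.tailBound n) := by
  obtain ⟨r, hr, h⟩ := exists_diag_eq hg n a
  rw [h]
  have := partialDiag_pos (g := g) n a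
  gcongr
  exact (abs_le.1 hr).2

lemma partialDiag_le (hg : g.L1Bounded) (n : ℕ) (a : A) :
    g.partialDiag n a ≤ g.diag a * Real.exp (g.tailBound n) := by
  obtain ⟨r, hr, h⟩ := exists_diag_eq hg n a
  rw [h, mul_assoc, ← Real.exp_add]
  refine le_mul_of_one_le_right (partialDiag_pos n a).le (Real.one_le_exp ?_)
  linarith [(abs_le.1 hr).1]

lemma eval_le (hg : g.L1Bounded) (x : Seq A) :
    g.eval x ≤ g.const * Real.exp (g.tailBound 0) * g.factor 0 (x 0) := by
  obtain ⟨r, hr, h⟩ := exists_eval_eq hg 0 x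
  have h0 := g.const_pos
  have h1 := g.factor_pos 0 (x 0)
  rw [h, zero_add, Finset.prod_range_one, mul_right_comm]
  gcongr
  exact (abs_le.1 hr).2

lemma summable_diag (hg : g.L1Bounded) (hs : g.IsSummable) : Summable g.diag := by
  refine .of_nonneg_of_le (fun a => (diag_pos hg a).le) (fun a => diag_le hg 0 a) ?_
  exact (hs.congr fun a => by simp [partialDiag]).mul_right _

lemma summable_partialDiag (hg : g.L1Bounded) (hs : g.IsSummable) (n : ℕ) :
    Summable (g.partialDiag n) :=
  .of_nonneg_of_le (fun a => (partialDiag_pos n a).le) (fun a => partialDiag_le hg n a)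
    ((summable_diag hg hs).mul_right _)

/-- The comparison of `partialDiag n` with `diag` by the factors exp(±`tailBound n`) is uniform in
the letter, so it survives summation over an infinite alphabet and a squeeze suffices. -/
lemma tendsto_partialTotal (hg : g.L1Bounded) (hs : g.IsSummable) :
    Tendsto g.partialTotal atTop (𝓝 (∑' a, g.diag a)) := by
  have hexp : Tendsto (fun n => Real.exp (g.tailBound n)) atTop (𝓝 1) := by
    simpa [Function.comp_def] using
      (Real.continuous_exp.tendsto 0).comp (tendsto_tailBound (g := g))
  have hexp' : Tendsto (fun n => (Real.exp (g.tailBound n))⁻¹) atTop (𝓝 1) := by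
    simpa using hexp.inv₀ one_ne_zero
  refine tendsto_of_tendsto_of_tendsto_of_le_of_le
    (by simpa using hexp'.const_mul (∑' a, g.diag a))
    (by simpa using hexp.const_mul (∑' a, g.diag a)) (fun n => ?_) (fun n => ?_)
  · show (∑' a, g.diag a) * (Real.exp (g.tailBound n))⁻¹ ≤ _
    rw [← div_eq_mul_inv, div_le_iff₀ (Real.exp_pos _), partialTotal, ← tsum_mul_right]
    exact (summable_diag hg hs).tsum_le_tsum (diag_le hg n)
      ((summable_partialDiag hg hs n).mul_right _)
  · show g.partialTotal n ≤ (∑' a, g.diag a) * Real.exp (g.tailBound n)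
    rw [partialTotal, ← tsum_mul_right]
    exact (summable_partialDiag hg hs n).tsum_le_tsum (partialDiag_le hg n)
      ((summable_diag hg hs).mul_right _)

lemma conformalWeight_eq (n : ℕ) (a : A) :
    g.conformalWeight n a = g.partialDiag n a / g.partialTotal n := rfl

variable [Nonempty A]

lemma tsum_diag_pos (hg : g.L1Bounded) (hs : g.IsSummable) : 0 < ∑' a, g.diag a :=
  (summable_diag hg hs).tsum_pos (fun a => (diag_pos hg a).le) (Classical.arbitrary A)
    (diag_pos hg _)

lemma eigenvalue_pos (hg : g.L1Bounded) (hs : g.IsSummable) : 0 < g.eigenvalue :=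
  mul_pos g.const_pos (tsum_diag_pos hg hs)

lemma partialTotal_pos (hg : g.L1Bounded) (hs : g.IsSummable) (n : ℕ) : 0 < g.partialTotal n :=
  (summable_partialDiag hg hs n).tsum_pos (fun a => (partialDiag_pos n a).le)
    (Classical.arbitrary A) (partialDiag_pos n _)

lemma conformalWeight_pos (hg : g.L1Bounded) (hs : g.IsSummable) (n : ℕ) (a : A) :
    0 < g.conformalWeight n a :=
  div_pos (partialDiag_pos n a) (partialTotal_pos hg hs n)

lemma hasSum_conformalWeight (hg : g.L1Bounded) (hs : g.IsSummable) (n : ℕ) :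
    HasSum (g.conformalWeight n) 1 := by
  have h := (summable_partialDiag hg hs n).hasSum.div_const (g.partialTotal n)
  rwa [← partialTotal, div_self (partialTotal_pos hg hs n).ne'] at h

/-- The ratios of successive normalizations telescope. This is the exact algebra behind both the
conformality of μ and the value of the eigenvalue. -/
lemma prod_factor_mul_prod_conformalWeight (hg : g.L1Bounded) (hs : g.IsSummable)
    {n : ℕ} (w : Fin (n + 1) → A) :
    (∏ k : Fin (n + 1), g.factor k (w k)) * ∏ i : Fin n, g.conformalWeight i (w i.succ) =
      g.partialTotal n * ∏ k : Fin (n + 1), g.conformalWeight k (w k) := by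
  have hZ := fun n => (partialTotal_pos hg hs n).ne'
  have h1 : ∀ i : Fin n, g.factor (i + 1) (w i.succ) * g.conformalWeight i (w i.succ) =
      g.conformalWeight (i + 1) (w i.succ) * (g.partialTotal (i + 1) / g.partialTotal i) := by
    intro i
    rw [conformalWeight_eq, conformalWeight_eq, partialDiag_succ]
    field_simp [hZ i, hZ (i + 1)]
  have h2 : ∏ i : Fin n, g.partialTotal (i + 1) / g.partialTotal i =
      g.partialTotal n / g.partialTotal 0 := by
    rw [← Finset.prod_range (fun i => g.partialTotal (i + 1) / g.partialTotal i)]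
    induction n with
    | zero => simp [hZ 0]
    | succ n ih =>
      rw [Finset.prod_range_succ, ih (fun i => w i.castSucc) (fun i => h1 i.castSucc)]
      have := hZ n
      field_simp
  have h3 : g.factor 0 (w 0) = g.partialTotal 0 * g.conformalWeight 0 (w 0) := by
    rw [conformalWeight_eq, mul_div_cancel₀ _ (hZ 0)]
    simp [partialDiag]
  rw [Fin.prod_univ_succ, Fin.prod_univ_succ, mul_assoc, ← Finset.prod_mul_distrib]
  simp only [Fin.val_succ, Fin.val_zero]
  rw [Finset.prod_congr rfl fun i _ => h1 i, Finset.prod_mul_distrib, h2, h3]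
  have := hZ 0
  field_simp

lemma bernoulliWeight_pos (hg : g.L1Bounded) (hs : g.IsSummable) (a : A) :
    0 < g.bernoulliWeight a :=
  div_pos (diag_pos hg a) (tsum_diag_pos hg hs)

lemma hasSum_bernoulliWeight (hg : g.L1Bounded) (hs : g.IsSummable) :
    HasSum g.bernoulliWeight 1 := by
  have h := (summable_diag hg hs).hasSum.div_const (∑' a, g.diag a)
  rwa [div_self (tsum_diag_pos hg hs).ne'] at h

end Potential

/-! ### Cylinder sets and product measures -/

/-- The sequence `(a, x₁, x₂, …)`. -/
def cons {A : Type*} (a : A) (x : Seq A) : Seq A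
  | 0 => a
  | n + 1 => x n

section Shift

variable {A : Type*}

@[simp] lemma cons_zero (a : A) (x : Seq A) : cons a x 0 = a := rfl

@[simp] lemma cons_succ (a : A) (x : Seq A) (n : ℕ) : cons a x (n + 1) = x n := rfl

lemma cons_shift (x : Seq A) : cons (x 0) (shift x) = x := by
  funext n; cases n <;> rfl

lemma shift_iterate_apply (i : ℕ) (x : Seq A) (n : ℕ) : shift^[i] x n = x (n + i) := by
  induction i generalizing n with
  | zero => rfl
  | succ i ih =>
    rw [Function.iterate_succ_apply']
    show shift^[i] x (n + 1) = _
    rw [ih, show n + 1 + i = n + (i + 1) by ring]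

/-- The preimages of a point under the shift are indexed by the letters. -/
def preimageEquiv (x : Seq A) : A ≃ {y : Seq A // shift y = x} where
  toFun a := ⟨cons a x, rfl⟩
  invFun y := y.1 0
  left_inv _ := rfl
  right_inv := by
    rintro ⟨y, rfl⟩
    exact Subtype.ext (cons_shift y)

lemma ruelle_eq (f φ : Seq A → ℝ) (x : Seq A) :
    ruelle f φ x = ∑' a, φ (cons a x) * Real.exp (f (cons a x)) :=
  ((preimageEquiv x).tsum_eq fun y => φ y * Real.exp (f y)).symm

lemma cylinder_nonempty [Nonempty A] {n : ℕ} (w : Fin n → A) : (cylinder w).Nonempty :=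
  ⟨fun i => if h : i < n then w ⟨i, h⟩ else Classical.arbitrary A, fun i => by simp⟩

lemma iUnion_cylinder_snoc {n : ℕ} (w : Fin n → A) :
    ⋃ b, cylinder (Fin.snoc w b : Fin (n + 1) → A) = cylinder w := by
  ext x
  simp only [Set.mem_iUnion, cylinder, Set.mem_ofPred_eq, Fin.forall_fin_succ', Fin.snoc_castSucc,
    Fin.snoc_last, Fin.val_castSucc, Fin.val_last]
  exact ⟨fun ⟨_, h, _⟩ => h, fun h => ⟨_, h, rfl⟩⟩

lemma disjoint_cylinder {n : ℕ} {v w : Fin n → A} (h : v ≠ w) :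
    Disjoint (cylinder v) (cylinder w) :=
  Set.disjoint_left.2 fun _ hv hw => h (funext fun i => (hv i).symm.trans (hw i))

lemma iUnion_cylinder (n : ℕ) : ⋃ w : Fin n → A, cylinder w = Set.univ :=
  Set.eq_univ_of_forall fun x => Set.mem_iUnion.2 ⟨fun i => x i, fun _ => rfl⟩

/-- Two cylinders that meet are nested, the longer word extending the shorter one. -/
lemma isPiSystem_cylinder :
    IsPiSystem {s : Set (Seq A) | ∃ (n : ℕ) (w : Fin n → A), s = cylinder w} := by
  have key : ∀ {k n : ℕ} (v : Fin k → A) (w : Fin n → A), k ≤ n →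
      (cylinder v ∩ cylinder w).Nonempty → cylinder w ⊆ cylinder v := by
    rintro k n v w hkn ⟨x, hv, hw⟩ y hy i
    rw [← hv i]
    exact (hy (Fin.castLE hkn i)).trans (hw (Fin.castLE hkn i)).symm
  rintro _ ⟨k, v, rfl⟩ _ ⟨n, w, rfl⟩ hne
  rcases le_total k n with h | h
  · exact ⟨n, w, Set.inter_eq_right.2 (key v w h hne)⟩
  · exact ⟨k, v, Set.inter_eq_left.2 (key w v h (by rwa [Set.inter_comm]))⟩

end Shift

section Measures

variable {A : Type*} [MeasurableSpace A]

lemma measurable_shift : Measurable (shift : Seq A → Seq A) :=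
  measurable_pi_lambda _ fun n => measurable_pi_apply (n + 1)

lemma measurable_cons (a : A) : Measurable (cons a : Seq A → Seq A) := by
  refine measurable_pi_lambda _ fun n => ?_
  cases n with
  | zero => exact measurable_const
  | succ n => exact measurable_pi_apply n

lemma measurableSet_cylinder [MeasurableSingletonClass A] {n : ℕ} (w : Fin n → A) :
    MeasurableSet (cylinder w) := by
  have : cylinder w = ⋂ i : Fin n, (fun x : Seq A => x i) ⁻¹' {w i} := by
    ext x; simp [cylinder]
  rw [this]
  exact .iInter fun i => measurable_pi_apply _ (measurableSet_singleton _)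

lemma letterMeasure_singleton [Countable A] [MeasurableSingletonClass A] (p : A → ℝ) (a : A) :
    letterMeasure p {a} = ENNReal.ofReal (p a) := by
  rw [letterMeasure, Measure.sum_apply _ (measurableSet_singleton a), tsum_eq_single a]
  · simp
  · intro b hb
    simp [hb]

lemma isProbabilityMeasure_letterMeasure {p : A → ℝ} (h0 : ∀ a, 0 ≤ p a) (h1 : HasSum p 1) :
    IsProbabilityMeasure (letterMeasure p) := by
  constructor
  rw [letterMeasure, Measure.sum_apply _ .univ]
  simp only [Measure.smul_apply, measure_univ, smul_eq_mul, mul_one]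
  rw [← ENNReal.ofReal_tsum_of_nonneg h0 h1.summable, h1.tsum_eq, ENNReal.ofReal_one]

lemma isProbabilityMeasure_productMeasure {p : ℕ → A → ℝ} (h0 : ∀ n a, 0 ≤ p n a)
    (h1 : ∀ n, HasSum (p n) 1) : IsProbabilityMeasure (productMeasure p) := by
  have := fun n => isProbabilityMeasure_letterMeasure (h0 n) (h1 n)
  unfold productMeasure
  infer_instance

/-- Sides more general than single letters are needed twice: a full first side for shift invariance,
and unions of letters for the entropy of coarse partitions. -/
lemma productMeasure_box {p : ℕ → A → ℝ} (h0 : ∀ n a, 0 ≤ p n a)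
    (h1 : ∀ n, HasSum (p n) 1) {n : ℕ} (t : Fin n → Set A) (ht : ∀ i, MeasurableSet (t i)) :
    productMeasure p {x | ∀ i : Fin n, x i ∈ t i} = ∏ i : Fin n, letterMeasure (p i) (t i) := by
  have := fun n => isProbabilityMeasure_letterMeasure (h0 n) (h1 n)
  let t' : ℕ → Set A := fun i => if h : i < n then t ⟨i, h⟩ else Set.univ
  have hset : {x : Seq A | ∀ i : Fin n, x i ∈ t i} = Set.pi (Finset.range n) t' := by
    ext x
    simp only [Set.mem_ofPred_eq, Set.mem_pi, Finset.coe_range, Set.mem_Iio]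
    constructor
    · intro h i hi
      simpa [t', hi] using h ⟨i, hi⟩
    · intro h i
      simpa [t'] using h i i.2
  rw [hset, productMeasure, Measure.infinitePi_pi]
  · rw [Finset.prod_range]
    exact Finset.prod_congr rfl fun i _ => by simp [t']
  · intro i hi
    have hi' : i < n := by simpa using hi
    simpa [t', hi'] using ht ⟨i, hi'⟩

variable [Countable A] [MeasurableSingletonClass A]

lemma productMeasure_cylinder {p : ℕ → A → ℝ} (h0 : ∀ n a, 0 ≤ p n a)
    (h1 : ∀ n, HasSum (p n) 1) {n : ℕ} (w : Fin n → A) :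
    productMeasure p (cylinder w) = ENNReal.ofReal (∏ i : Fin n, p i (w i)) := by
  have h := productMeasure_box h0 h1 (fun i => {w i}) fun i => measurableSet_singleton _
  simp only [letterMeasure_singleton, Set.mem_singleton_iff] at h
  rw [ENNReal.ofReal_prod_of_nonneg fun i _ => h0 _ _]
  exact h

lemma measure_cylinder_eq_tsum (M : Measure (Seq A)) {n : ℕ} (w : Fin n → A) :
    M (cylinder w) = ∑' b, M (cylinder (Fin.snoc w b : Fin (n + 1) → A)) := by
  rw [← iUnion_cylinder_snoc w, measure_iUnion]
  · intro a b hab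
    refine disjoint_cylinder fun h => hab ?_
    simpa using congrFun h (Fin.last n)
  · exact fun b => measurableSet_cylinder _

lemma tsum_measure_cylinder (M : Measure (Seq A)) (n : ℕ) :
    ∑' w : Fin n → A, M (cylinder w) = M Set.univ := by
  rw [← iUnion_cylinder n, measure_iUnion (fun v w h => disjoint_cylinder h)
    fun w => measurableSet_cylinder w]

/-- An inequality between the measures of the cylinders of one length extends to the shorter
cylinders. -/
lemma measure_cylinder_le_of_le {M N : Measure (Seq A)} {n : ℕ} {K : ℝ≥0∞}
    (h : ∀ w : Fin n → A, M (cylinder w) ≤ K * N (cylinder w)) {l : ℕ} (hl : l ≤ n)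
    (w : Fin l → A) : M (cylinder w) ≤ K * N (cylinder w) := by
  induction n, hl using Nat.le_induction with
  | base => exact h w
  | succ n _ ih =>
    refine ih fun v => ?_
    rw [measure_cylinder_eq_tsum M, measure_cylinder_eq_tsum N, ← ENNReal.tsum_mul_left]
    exact ENNReal.tsum_le_tsum fun b => h _

lemma generateFrom_cylinder :
    (inferInstance : MeasurableSpace (Seq A)) =
      MeasurableSpace.generateFrom {s | ∃ (n : ℕ) (w : Fin n → A), s = cylinder w} := by
  refine le_antisymm (iSup_le fun i => ?_) (MeasurableSpace.generateFrom_le ?_)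
  · rw [← measurable_iff_comap_le]
    refine @measurable_to_countable' A (Seq A) _ _ (.generateFrom _) _ fun a => ?_
    have : (fun x : Seq A => x i) ⁻¹' {a} =
        ⋃ w : {w : Fin (i + 1) → A // w (Fin.last i) = a}, cylinder w.1 := by
      ext x
      simp only [Set.mem_preimage, Set.mem_singleton_iff, Set.mem_iUnion]
      constructor
      · exact fun h => ⟨⟨fun j => x j, by simpa using h⟩, fun j => rfl⟩
      · rintro ⟨⟨w, rfl⟩, h⟩
        exact h (Fin.last i)
    rw [this]
    exact .iUnion fun w => MeasurableSpace.measurableSet_generateFrom ⟨_, _, rfl⟩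
  · rintro _ ⟨n, w, rfl⟩
    exact measurableSet_cylinder w

lemma ext_of_cylinder {M N : Measure (Seq A)} [IsFiniteMeasure M]
    (h : ∀ (n : ℕ) (w : Fin n → A), M (cylinder w) = N (cylinder w)) : M = N := by
  refine ext_of_generate_finite _ generateFrom_cylinder isPiSystem_cylinder ?_ ?_
  · rintro _ ⟨n, w, rfl⟩
    exact h n w
  · rw [← tsum_measure_cylinder M 0, ← tsum_measure_cylinder N 0]
    exact tsum_congr fun w => h 0 w

lemma measurePreserving_shift_productMeasure {p : A → ℝ} (h0 : ∀ a, 0 ≤ p a)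
    (h1 : HasSum p 1) :
    MeasurePreserving shift (productMeasure fun _ => p) (productMeasure fun _ => p) := by
  have := isProbabilityMeasure_productMeasure (fun _ : ℕ => h0) fun _ => h1
  have := isProbabilityMeasure_letterMeasure h0 h1
  have := Measure.isProbabilityMeasure_map (μ := productMeasure fun _ : ℕ => p)
    (measurable_shift (A := A)).aemeasurable
  refine ⟨measurable_shift, ext_of_cylinder fun n w => ?_⟩
  rw [Measure.map_apply measurable_shift (measurableSet_cylinder w),
    productMeasure_cylinder (fun _ => h0) fun _ => h1]
  -- The shift preimage of a cylinder is a box whose first side is the whole alphabet and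
  -- contributes the factor 1.
  have h := productMeasure_box (fun _ : ℕ => h0) (fun _ => h1)
    (Fin.cons Set.univ fun i => {w i} : Fin (n + 1) → Set A) (by
      intro i
      cases i using Fin.cases with
      | zero => exact .univ
      | succ i => exact measurableSet_singleton _)
  rw [Fin.prod_univ_succ] at h
  simp only [Fin.cons_zero, Fin.cons_succ, measure_univ, one_mul, letterMeasure_singleton,
    Fin.forall_fin_succ, Set.mem_univ, true_and, Set.mem_singleton_iff, Fin.val_succ] at h
  rw [ENNReal.ofReal_prod_of_nonneg fun i _ => h0 _]
  exact h

end Measures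

namespace Potential

variable {A : Type*} [Nonempty A] [MeasurableSpace A] {g : Potential A}

lemma isProbabilityMeasure_conformalMeasure (hg : g.L1Bounded) (hs : g.IsSummable) :
    IsProbabilityMeasure g.conformalMeasure :=
  isProbabilityMeasure_productMeasure (fun n a => (conformalWeight_pos hg hs n a).le)
    (hasSum_conformalWeight hg hs)

lemma isProbabilityMeasure_bernoulliMeasure (hg : g.L1Bounded) (hs : g.IsSummable) :
    IsProbabilityMeasure g.bernoulliMeasure :=
  isProbabilityMeasure_productMeasure (fun _ a => (bernoulliWeight_pos hg hs a).le)
    fun _ => hasSum_bernoulliWeight hg hs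

lemma bernoulliMeasure_mem_invariantMeasures [Countable A] [MeasurableSingletonClass A]
    (hg : g.L1Bounded) (hs : g.IsSummable) : g.bernoulliMeasure ∈ invariantMeasures A :=
  ⟨isProbabilityMeasure_bernoulliMeasure hg hs, measurePreserving_shift_productMeasure
    (fun a => (bernoulliWeight_pos hg hs a).le) (hasSum_bernoulliWeight hg hs)⟩

end Potential

/-! ### The dual of the Ruelle operator -/

namespace Potential

variable {A : Type*} [MeasurableSpace A] {g : Potential A}

lemma measurable_logEval [DiscreteMeasurableSpace A] (hg : g.L1Bounded) :
    Measurable g.logEval := by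
  rw [funext (logEval_eq hg)]
  refine measurable_const.add (Measurable.tsum fun n => ?_)
  exact (Measurable.of_discrete (f := fun a => Real.log (g.factor n a))).comp
    (measurable_pi_apply n)

lemma measurable_eval [DiscreteMeasurableSpace A] (hg : g.L1Bounded) : Measurable g.eval := by
  rw [← funext (exp_logEval hg)]
  exact Real.measurable_exp.comp (measurable_logEval hg)

/-- The measure `L_{log g}^* m`. -/
def dualMeasure (g : Potential A) (m : Measure (Seq A)) : Measure (Seq A) :=
  Measure.sum fun a =>
    (m.withDensity fun x => ENNReal.ofReal (g.eval (cons a x))).map (cons a)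

variable [MeasurableSingletonClass A]

lemma dualMeasure_cylinder (m : Measure (Seq A)) {n : ℕ} (w : Fin (n + 1) → A) :
    g.dualMeasure m (cylinder w) =
      ∫⁻ x in cylinder (Fin.tail w), ENNReal.ofReal (g.eval (cons (w 0) x)) ∂m := by
  have hpre : ∀ a : A, cons a ⁻¹' cylinder w =
      {x | a = w 0} ∩ cylinder (Fin.tail w) := by
    intro a
    ext x
    simp [cylinder, Fin.forall_fin_succ, Fin.tail]
  rw [dualMeasure, Measure.sum_apply _ (measurableSet_cylinder w), tsum_eq_single (w 0)]
  · rw [Measure.map_apply (measurable_cons _) (measurableSet_cylinder w), hpre,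
      withDensity_apply _ (by simpa using measurableSet_cylinder _)]
    simp
  · intro a ha
    rw [Measure.map_apply (measurable_cons _) (measurableSet_cylinder w), hpre]
    simp [ha]

variable [Countable A] [Nonempty A]

/-- On the cylinder of `Fin.tail w`, the density `g.eval (cons (w 0) x)` is constant up to
exp(±`tailBound n`), and the constant is handled by `prod_factor_mul_prod_conformalWeight`. Both
inequalities have the form required by `measure_cylinder_le_of_le`. -/
lemma dualMeasure_cylinder_bounds (hg : g.L1Bounded) (hs : g.IsSummable) {n : ℕ}
    (w : Fin (n + 1) → A) :
    g.dualMeasure g.conformalMeasure (cylinder w) ≤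
      ENNReal.ofReal (Real.exp (g.tailBound n) * (g.const * g.partialTotal n)) *
        g.conformalMeasure (cylinder w) ∧
    g.conformalMeasure (cylinder w) ≤
      ENNReal.ofReal (Real.exp (g.tailBound n) * (g.const * g.partialTotal n)⁻¹) *
        g.dualMeasure g.conformalMeasure (cylinder w) := by
  have hZ := partialTotal_pos hg hs n
  have hc := g.const_pos
  have hw : ∀ x ∈ cylinder (Fin.tail w), ∃ r, |r| ≤ g.tailBound n ∧
      g.eval (cons (w 0) x) = g.const * (∏ k : Fin (n + 1), g.factor k (w k)) * Real.exp r := by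
    intro x hx
    obtain ⟨r, hr, h⟩ := exists_eval_eq hg n (cons (w 0) x)
    refine ⟨r, hr, ?_⟩
    rw [h, Finset.prod_range]
    congr 2
    refine Finset.prod_congr rfl fun k _ => ?_
    cases k using Fin.cases with
    | zero => simp
    | succ k => simp [hx k, Fin.tail]
  have hB : 0 < g.const * ∏ k : Fin (n + 1), g.factor k (w k) :=
    mul_pos hc (Finset.prod_pos fun k _ => g.factor_pos _ _)
  have hprod := prod_factor_mul_prod_conformalWeight hg hs w
  have h0 := fun n a => (conformalWeight_pos hg hs n a).le
  have h1 := hasSum_conformalWeight hg hs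
  have hμ : ∀ s : ℝ, ENNReal.ofReal (g.const * (∏ k : Fin (n + 1), g.factor k (w k)) * Real.exp s) *
      g.conformalMeasure (cylinder (Fin.tail w)) =
      ENNReal.ofReal (Real.exp s * (g.const * g.partialTotal n)) *
        g.conformalMeasure (cylinder w) := by
    intro s
    rw [conformalMeasure, productMeasure_cylinder h0 h1, productMeasure_cylinder h0 h1,
      ← ENNReal.ofReal_mul (by positivity), ← ENNReal.ofReal_mul (by positivity)]
    congr 1
    simp only [Fin.tail]
    linear_combination g.const * Real.exp s * hprod
  rw [dualMeasure_cylinder]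
  constructor
  · rw [← hμ, ← setLIntegral_const]
    refine setLIntegral_mono measurable_const fun x hx => ENNReal.ofReal_le_ofReal ?_
    obtain ⟨r, hr, h⟩ := hw x hx
    rw [h]
    gcongr
    exact (abs_le.1 hr).2
  · have hlow : ENNReal.ofReal (Real.exp (-g.tailBound n) * (g.const * g.partialTotal n)) *
        g.conformalMeasure (cylinder w) ≤
        ∫⁻ x in cylinder (Fin.tail w), ENNReal.ofReal (g.eval (cons (w 0) x))
          ∂g.conformalMeasure := by
      rw [← hμ, ← setLIntegral_const]
      refine setLIntegral_mono' (measurableSet_cylinder _) fun x hx =>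
        ENNReal.ofReal_le_ofReal ?_
      obtain ⟨r, hr, h⟩ := hw x hx
      rw [h]
      gcongr
      exact (abs_le.1 hr).1
    refine le_trans ?_ (mul_le_mul_right hlow _)
    rw [← mul_assoc, ← ENNReal.ofReal_mul (by positivity),
      show Real.exp (g.tailBound n) * (g.const * g.partialTotal n)⁻¹ *
        (Real.exp (-g.tailBound n) * (g.const * g.partialTotal n)) = 1 by
          rw [Real.exp_neg]
          have := Real.exp_pos (g.tailBound n)
          field_simp]
    simp

/-- The product measure of the conformal weights is an eigenmeasure of the dual operator. -/
lemma dualMeasure_conformalMeasure (hg : g.L1Bounded) (hs : g.IsSummable) :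
    g.dualMeasure g.conformalMeasure = ENNReal.ofReal g.eigenvalue • g.conformalMeasure := by
  have hprob := isProbabilityMeasure_conformalMeasure hg hs
  have hfin : IsFiniteMeasure (ENNReal.ofReal g.eigenvalue • g.conformalMeasure) :=
    ⟨by simp⟩
  have hpos := eigenvalue_pos hg hs
  have hexp : Tendsto (fun n => Real.exp (g.tailBound n)) atTop (𝓝 1) := by
    simpa [Function.comp_def] using
      (Real.continuous_exp.tendsto 0).comp (tendsto_tailBound (g := g))
  have hZ : Tendsto (fun n => g.const * g.partialTotal n) atTop (𝓝 g.eigenvalue) :=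
    (tendsto_partialTotal hg hs).const_mul _
  -- The equation is reversed because `ext_of_cylinder` needs its first measure to be finite, and
  -- finiteness of the dual measure is only a consequence of the equality.
  refine (ext_of_cylinder fun l w => le_antisymm ?_ ?_).symm
  · have hlim : Tendsto (fun n => ENNReal.ofReal
        (Real.exp (g.tailBound n) * (g.const * g.partialTotal n)⁻¹) *
          g.dualMeasure g.conformalMeasure (cylinder w)) atTop
        (𝓝 (ENNReal.ofReal g.eigenvalue⁻¹ * g.dualMeasure g.conformalMeasure (cylinder w))) := by
      refine ENNReal.Tendsto.mul_const (ENNReal.tendsto_ofReal ?_) (Or.inl ?_)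
      · simpa using hexp.mul (hZ.inv₀ hpos.ne')
      · simpa using hpos
    have hle := ge_of_tendsto hlim (eventually_atTop.2 ⟨l, fun n hn =>
      measure_cylinder_le_of_le (fun v => (dualMeasure_cylinder_bounds hg hs v).2)
        (Nat.le_succ_of_le hn) w⟩)
    rw [Measure.smul_apply, smul_eq_mul]
    refine (mul_le_mul_right hle _).trans_eq ?_
    rw [← mul_assoc, ← ENNReal.ofReal_mul hpos.le, mul_inv_cancel₀ hpos.ne']
    simp
  · have hlim : Tendsto (fun n => ENNReal.ofReal
        (Real.exp (g.tailBound n) * (g.const * g.partialTotal n)) *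
          g.conformalMeasure (cylinder w)) atTop
        (𝓝 (ENNReal.ofReal g.eigenvalue * g.conformalMeasure (cylinder w))) := by
      refine ENNReal.Tendsto.mul_const (ENNReal.tendsto_ofReal ?_) (Or.inr (by simp))
      simpa using hexp.mul hZ
    exact ge_of_tendsto hlim (eventually_atTop.2 ⟨l, fun n hn =>
      measure_cylinder_le_of_le (fun v => (dualMeasure_cylinder_bounds hg hs v).1)
        (Nat.le_succ_of_le hn) w⟩)

lemma isDualImage_logEval [TopologicalSpace A] [DiscreteTopology A] [BorelSpace A]
    (hg : g.L1Bounded) (hs : g.IsSummable) :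
    IsDualImage g.logEval g.conformalMeasure
      (ENNReal.ofReal g.eigenvalue • g.conformalMeasure) := by
  intro φ
  have hprob := isProbabilityMeasure_conformalMeasure hg hs
  have hfin : IsFiniteMeasure (ENNReal.ofReal g.eigenvalue • g.conformalMeasure) :=
    ⟨by simp⟩
  have hφ : Measurable φ := φ.continuous.measurable
  set F : A → Seq A → ℝ := fun a x => φ (cons a x) * Real.exp (g.logEval (cons a x)) with hF
  have hFm : ∀ a, Measurable (F a) := fun a =>
    (hφ.comp (measurable_cons a)).mul
      (Real.measurable_exp.comp ((measurable_logEval hg).comp (measurable_cons a)))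
  -- This majorant is uniform in `x` and summable over the letters; it yields the convergence of the
  -- Ruelle sum, its integrability and the interchange of sum and integral.
  set b : A → ℝ := fun a => ‖φ‖ * (g.const * Real.exp (g.tailBound 0) * g.factor 0 a)
  have hb : Summable b := (Summable.mul_left _ hs).mul_left _
  have hFb : ∀ a x, ‖F a x‖ ≤ b a := by
    intro a x
    rw [hF, norm_mul, exp_logEval hg, Real.norm_of_nonneg (eval_pos hg _).le]
    exact mul_le_mul (φ.norm_coe_le_norm _) (eval_le hg _) (eval_pos hg _).le (norm_nonneg _)
  have hFi : ∀ a, Integrable (F a) g.conformalMeasure := fun a =>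
    .of_bound (hFm a).aestronglyMeasurable (b a) (ae_of_all _ (hFb a))
  have hsumm : ∀ x, Summable fun a => F a x := fun x => .of_norm_bounded hb fun a => hFb a x
  have hruelle : ruelle g.logEval φ = fun x => ∑' a, F a x := funext (ruelle_eq _ _)
  refine ⟨fun x => ?_, ?_, ?_⟩
  · exact (preimageEquiv x).summable_iff.1 (hsumm x)
  · rw [hruelle]
    refine .of_bound (Measurable.tsum hFm).aestronglyMeasurable (∑' a, b a)
      (ae_of_all _ fun x => ?_)
    exact tsum_of_norm_bounded hb.hasSum fun a => hFb a x
  · have hfint : Integrable φ (g.dualMeasure g.conformalMeasure) := by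
      rw [dualMeasure_conformalMeasure hg hs]
      exact φ.integrable _
    rw [hruelle, ← integral_tsum_of_summable_integral_norm hFi,
      ← dualMeasure_conformalMeasure hg hs, dualMeasure, integral_sum_measure hfint]
    · refine tsum_congr fun a => ?_
      rw [integral_map (measurable_cons a).aemeasurable hφ.aestronglyMeasurable,
        integral_withDensity_eq_integral_toReal_smul
          (f := fun x => ENNReal.ofReal (g.eval (cons a x)))
          ((measurable_eval hg).comp (measurable_cons a)).ennreal_ofReal
          (ae_of_all _ fun x => ENNReal.ofReal_lt_top)]
      refine integral_congr_ae (ae_of_all _ fun x => ?_)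
      simp only [hF, exp_logEval hg, ENNReal.toReal_ofReal (eval_pos hg _).le, smul_eq_mul]
      ring
    · refine .of_nonneg_of_le (fun a => integral_nonneg fun _ => norm_nonneg _) (fun a => ?_) hb
      calc ∫ x, ‖F a x‖ ∂g.conformalMeasure ≤ ∫ _, b a ∂g.conformalMeasure :=
            integral_mono (hFi a).norm (integrable_const _) (hFb a)
        _ = b a := by simp

/-- The potential of product type which depends on the first letter only, through `μ̃₀`. -/
def normalized (g : Potential A) (hg : g.L1Bounded) (hs : g.IsSummable) : Potential A where
  const := 1
  const_pos := one_pos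
  factor n a := if n = 0 then g.bernoulliWeight a else 1
  factor_pos n a := by
    split_ifs
    exacts [bernoulliWeight_pos hg hs a, one_pos]

/-- The normalized function is itself of product type with all factors after the first equal to 1.
Its conformal weights are therefore all μ̃₀ and its eigenvalue is 1, so `isDualImage_logEval`
applies. -/
lemma isDualImage_logNormalized [TopologicalSpace A] [DiscreteTopology A] [BorelSpace A]
    (hg : g.L1Bounded) (hs : g.IsSummable) :
    IsDualImage g.logNormalized g.bernoulliMeasure g.bernoulliMeasure := by
  set q := g.normalized hg hs with hq
  have h1 : q.L1Bounded := by simp [L1Bounded, hq, normalized]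
  have h2 : q.IsSummable := by
    simpa [IsSummable, hq, normalized] using (hasSum_bernoulliWeight hg hs).summable
  have hpart : ∀ n, q.partialDiag n = g.bernoulliWeight := fun n => by
    funext a
    simp [partialDiag, hq, normalized]
  have hlog : ∀ x : Seq A, ∑' n, Real.log (q.factor n (x n)) = Real.log (g.bernoulliWeight (x 0)) := by
    intro x
    rw [tsum_eq_single 0 fun n hn => by simp [hq, normalized, hn]]
    simp [hq, normalized]
  have hdiag : q.diag = g.bernoulliWeight := by
    funext a
    rw [diag_eq h1, hlog fun _ => a, Real.exp_log (bernoulliWeight_pos hg hs a)]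
  have heig : q.eigenvalue = 1 := by
    rw [eigenvalue, hdiag, (hasSum_bernoulliWeight hg hs).tsum_eq]
    simp [hq, normalized]
  have hmeas : q.conformalMeasure = g.bernoulliMeasure := by
    rw [conformalMeasure, bernoulliMeasure]
    congr 1
    funext n a
    rw [conformalWeight_eq, partialTotal, hpart, (hasSum_bernoulliWeight hg hs).tsum_eq, div_one]
  have heval : q.logEval = g.logNormalized := by
    funext x
    rw [logEval_eq h1, hlog]
    simp [hq, normalized, logNormalized, bernoulliWeight]
  have := isDualImage_logEval h1 h2
  rwa [heig, hmeas, heval, ENNReal.ofReal_one, one_smul] at this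

end Potential

/-! ### Pressure -/

namespace Potential

variable {A : Type*} {g : Potential A}

/-- Grouping the pairs with `k + i = m` collects the factors evaluated at the letter `x m`, each of
index 0, …, `m` occurring once. -/
lemma prod_prod_factor (n : ℕ) (x : Seq A) :
    ∏ i ∈ Finset.range n, ∏ k ∈ Finset.range (n - i), g.factor k (x (k + i)) =
      ∏ m ∈ Finset.range n, g.partialDiag m (x m) := by
  rw [← Finset.prod_range_diag_flip n fun i k => g.factor k (x (k + i))]
  refine Finset.prod_congr rfl fun m _ => ?_
  rw [partialDiag, ← Finset.prod_range_reflect]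
  refine Finset.prod_congr rfl fun k hk => ?_
  have hk' : k ≤ m := Nat.lt_succ_iff.1 (Finset.mem_range.1 hk)
  rw [show m - (m + 1 - 1 - k) = k by omega, show k + (m + 1 - 1 - k) = m by omega]

/-- The product `g(x) g(Tx) ⋯ g(T^{n-1}x)` in terms of the conformal weights. -/
lemma exists_prod_exp_logEval_eq [Nonempty A] (hg : g.L1Bounded) (hs : g.IsSummable) (n : ℕ)
    (x : Seq A) :
    ∃ r, |r| ≤ ∑ j ∈ Finset.range n, g.tailBound j ∧
      ∏ i ∈ Finset.range n, Real.exp (g.logEval (shift^[i] x)) =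
        (∏ m ∈ Finset.range n, g.const * g.partialTotal m) * Real.exp r *
          ∏ m ∈ Finset.range n, g.conformalWeight m (x m) := by
  -- After `i` shifts, the letters up to `x (n - 1)` fill the first `n - i` factors, so the error
  -- left is `tailBound (n - 1 - i)`.
  choose r hr h using fun i => exists_eval_eq hg (n - 1 - i) (shift^[i] x)
  refine ⟨∑ i ∈ Finset.range n, r i, ?_, ?_⟩
  · rw [← Finset.sum_range_reflect g.tailBound]
    exact (Finset.abs_sum_le_sum_abs _ _).trans (Finset.sum_le_sum fun i _ => hr i)
  · have h1 : ∀ i ∈ Finset.range n, Real.exp (g.logEval (shift^[i] x)) =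
        g.const * (∏ k ∈ Finset.range (n - i), g.factor k (x (k + i))) * Real.exp (r i) := by
      intro i hi
      have hi' := Finset.mem_range.1 hi
      rw [exp_logEval hg, h i, show n - 1 - i + 1 = n - i by omega]
      simp only [shift_iterate_apply]
    rw [Finset.prod_congr rfl h1, Finset.prod_mul_distrib, Finset.prod_mul_distrib,
      prod_prod_factor, ← Real.exp_sum]
    have h2 : ∀ m ∈ Finset.range n, g.partialDiag m (x m) =
        g.partialTotal m * g.conformalWeight m (x m) := fun m _ => by
      rw [conformalWeight_eq, mul_div_cancel₀ _ (partialTotal_pos hg hs m).ne']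
    rw [Finset.prod_congr rfl h2, Finset.prod_mul_distrib, Finset.prod_mul_distrib]
    ring

variable [Nonempty A] [Countable A]

/-- Each summand is a constant times the μ-mass of its cylinder, up to the distortion, and these
masses add up to 1. -/
lemma partitionFunction_bounds (hg : g.L1Bounded) (hs : g.IsSummable) (n : ℕ) :
    ENNReal.ofReal ((∏ m ∈ Finset.range n, g.const * g.partialTotal m) *
        Real.exp (-∑ j ∈ Finset.range n, g.tailBound j)) ≤ partitionFunction g.logEval n ∧
      partitionFunction g.logEval n ≤
        ENNReal.ofReal ((∏ m ∈ Finset.range n, g.const * g.partialTotal m) *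
          Real.exp (∑ j ∈ Finset.range n, g.tailBound j)) := by
  let _ : MeasurableSpace A := ⊤
  have hprob := isProbabilityMeasure_conformalMeasure hg hs
  have hW : 0 ≤ ∏ m ∈ Finset.range n, g.const * g.partialTotal m :=
    Finset.prod_nonneg fun m _ => (mul_pos g.const_pos (partialTotal_pos hg hs m)).le
  have hone := (tsum_measure_cylinder g.conformalMeasure n).trans measure_univ
  have hterm : ∀ (w : Fin n → A), ∀ x ∈ cylinder w, ∃ r,
      |r| ≤ ∑ j ∈ Finset.range n, g.tailBound j ∧
      ENNReal.ofReal (∏ i ∈ Finset.range n, Real.exp (g.logEval (shift^[i] x))) =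
        ENNReal.ofReal ((∏ m ∈ Finset.range n, g.const * g.partialTotal m) * Real.exp r) *
          g.conformalMeasure (cylinder w) := by
    intro w x hx
    obtain ⟨r, hr, h⟩ := exists_prod_exp_logEval_eq hg hs n x
    refine ⟨r, hr, ?_⟩
    rw [h, ENNReal.ofReal_mul (by positivity), conformalMeasure,
      productMeasure_cylinder (fun n a => (conformalWeight_pos hg hs n a).le)
        (hasSum_conformalWeight hg hs), Finset.prod_range (fun m => g.conformalWeight m (x m))]
    congr 2
    exact Finset.prod_congr rfl fun i _ => by rw [hx i]
  constructor
  · rw [← mul_one (ENNReal.ofReal _), ← hone, ← ENNReal.tsum_mul_left]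
    refine ENNReal.tsum_le_tsum fun w => ?_
    obtain ⟨x, hx⟩ := cylinder_nonempty w
    obtain ⟨r, hr, h⟩ := hterm w x hx
    refine le_trans ?_ (le_iSup₂_of_le x hx h.ge)
    gcongr
    exact (abs_le.1 hr).1
  · rw [← mul_one (ENNReal.ofReal _), ← hone, ← ENNReal.tsum_mul_left]
    refine ENNReal.tsum_le_tsum fun w => iSup₂_le fun x hx => ?_
    obtain ⟨r, hr, h⟩ := hterm w x hx
    rw [h]
    gcongr
    exact (abs_le.1 hr).2

/-- The accumulated distortion may be unbounded, but it is a sum of terms tending to 0, so its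
Cesàro mean vanishes in the limit. -/
lemma hasPressure_logEval (hg : g.L1Bounded) (hs : g.IsSummable) :
    HasPressure g.logEval (Real.log g.eigenvalue : ℝ) := by
  have hZ := fun m => mul_pos g.const_pos (partialTotal_pos hg hs m)
  have hlim : Tendsto (fun m => Real.log (g.const * g.partialTotal m)) atTop
      (𝓝 (Real.log g.eigenvalue)) :=
    ((tendsto_partialTotal hg hs).const_mul _).log (eigenvalue_pos hg hs).ne'
  have hW : ∀ n, 0 < ∏ m ∈ Finset.range n, g.const * g.partialTotal m :=
    fun n => Finset.prod_pos fun m _ => hZ m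
  have hlog : ∀ (n : ℕ) (s : ℝ),
      ENNReal.log (ENNReal.ofReal ((∏ m ∈ Finset.range n, g.const * g.partialTotal m) *
        Real.exp s)) / (n : EReal) =
      (((n : ℝ)⁻¹ * ∑ m ∈ Finset.range n, Real.log (g.const * g.partialTotal m) +
        (n : ℝ)⁻¹ * s : ℝ) : EReal) := by
    intro n s
    rw [ENNReal.log_ofReal_of_pos (mul_pos (hW n) (Real.exp_pos _)),
      Real.log_mul (hW n).ne' (Real.exp_ne_zero _), Real.log_exp,
      Real.log_prod fun m _ => (hZ m).ne', ← EReal.coe_natCast, ← EReal.coe_div]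
    congr 1
    ring
  have h1 := hlim.cesaro
  have h2 := (tendsto_tailBound (g := g)).cesaro
  refine tendsto_of_tendsto_of_tendsto_of_le_of_le (g := fun n : ℕ =>
      (((n : ℝ)⁻¹ * ∑ m ∈ Finset.range n, Real.log (g.const * g.partialTotal m) +
        (n : ℝ)⁻¹ * (-∑ j ∈ Finset.range n, g.tailBound j) : ℝ) : EReal))
    (h := fun n : ℕ =>
      (((n : ℝ)⁻¹ * ∑ m ∈ Finset.range n, Real.log (g.const * g.partialTotal m) +
        (n : ℝ)⁻¹ * ∑ j ∈ Finset.range n, g.tailBound j : ℝ) : EReal)) ?_ ?_ ?_ ?_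
  · rw [EReal.tendsto_coe]
    simpa [sub_eq_add_neg] using h1.sub h2
  · rw [EReal.tendsto_coe]
    simpa using h1.add h2
  · intro n
    dsimp only
    rw [← hlog]
    exact EReal.div_le_div_right_of_nonneg (by positivity)
      (ENNReal.log_le_log (partitionFunction_bounds hg hs n).1)
  · intro n
    dsimp only
    rw [← hlog]
    exact EReal.div_le_div_right_of_nonneg (by positivity)
      (ENNReal.log_le_log (partitionFunction_bounds hg hs n).2)

end Potential

/-! ### An upper bound for the Kolmogorov–Sinai entropy -/

/-- The Gibbs inequality. -/
lemma sum_negMulLog_le {ι : Type*} [Fintype ι] {P q : ι → ℝ} (hP : ∀ i, 0 ≤ P i)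
    (hP1 : ∑ i, P i = 1) (hq : ∀ i, 0 < q i) (hq1 : ∑ i, q i ≤ 1) :
    ∑ i, Real.negMulLog (P i) ≤ ∑ i, P i * (-Real.log (q i)) := by
  -- This is log t ≤ t - 1 at t = `q i / P i`; the corrections `q i - P i` sum to at most 0, so `q`
  -- may be a subprobability.
  have key : ∀ i, Real.negMulLog (P i) ≤ P i * (-Real.log (q i)) + (q i - P i) := by
    intro i
    rcases (hP i).eq_or_lt with h | h
    · simpa [← h] using (hq i).le
    · have h1 := Real.log_le_sub_one_of_pos (div_pos (hq i) h)
      rw [Real.log_div (hq i).ne' h.ne'] at h1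
      have h2 := mul_le_mul_of_nonneg_left h1 h.le
      have h3 : P i * (q i / P i - 1) = q i - P i := by field_simp
      rw [Real.negMulLog]
      linarith
  refine (Finset.sum_le_sum fun i _ => key i).trans ?_
  rw [Finset.sum_add_distrib, Finset.sum_sub_distrib]
  linarith

section Entropy

variable {A : Type*} [MeasurableSpace A]

lemma measurable_shift_iterate (i : ℕ) : Measurable (shift^[i] : Seq A → Seq A) :=
  measurable_shift.iterate i

lemma integrable_comp_shift_iterate {m : Measure (Seq A)} (hm : MeasurePreserving shift m m)
    (i : ℕ) {f : Seq A → ℝ} (hf : Integrable f m) :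
    Integrable (fun x => f (shift^[i] x)) m :=
  (hm.iterate i).integrable_comp_of_integrable hf

lemma integral_comp_shift_iterate {m : Measure (Seq A)} (hm : MeasurePreserving shift m m)
    (i : ℕ) {f : Seq A → ℝ} (hf : AEStronglyMeasurable f m) :
    ∫ x, f (shift^[i] x) ∂m = ∫ x, f x ∂m := by
  have h := (hm.iterate i).map_eq
  rw [← integral_map (μ := m) (f := f) (measurable_shift_iterate i).aemeasurable (by rwa [h]), h]

/-- A finite partition is approximated by partitions into cylinder sets. -/
lemma exists_cylinder_approximation (m : Measure (Seq A)) [IsFiniteMeasure m] {k : ℕ}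
    {ξ : Seq A → Fin k} (hξ : Measurable ξ) {δ : ℝ} (hδ : 0 < δ) :
    ∃ (M : ℕ) (ζ : Seq A → Fin k), Measurable ζ ∧
      (∀ x y : Seq A, (∀ i < M, x i = y i) → ζ x = ζ y) ∧ m.real {x | ξ x ≠ ζ x} ≤ δ := by
  classical
  by_cases hA : Nonempty (Seq A)
  swap
  · rw [not_nonempty_iff] at hA
    exact ⟨0, ξ, hξ, fun x => (IsEmpty.false x).elim, by simpa using hδ.le⟩
  have hk : 0 < k := (ξ hA.some).pos
  have happ : ∀ j : Fin k, ∃ t ∈ measurableCylinders (fun _ : ℕ => A),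
      m (symmDiff t (ξ ⁻¹' {j})) < ENNReal.ofReal (δ / k) := fun j =>
    exists_measure_symmDiff_lt_of_generateFrom_isSetRing isSetRing_measurableCylinders
      ⟨{Set.univ}, Set.countable_singleton _, by
        simpa using univ_mem_measurableCylinders (fun _ : ℕ => A), by simp⟩
      generateFrom_measurableCylinders.symm (hξ (measurableSet_singleton j)) (by positivity)
  choose t ht hlt using happ
  choose s S hS hts using fun j => (mem_measurableCylinders (t j)).1 (ht j)
  have htm : ∀ j, MeasurableSet (t j) := fun j => .of_mem_measurableCylinders (ht j)
  obtain ⟨M, hM⟩ : ∃ M, ∀ j, ∀ i ∈ s j, i < M := by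
    refine ⟨(Finset.univ.biUnion s).sup id + 1, fun j i hi => Nat.lt_succ_of_le ?_⟩
    exact Finset.le_sup (f := id) (Finset.mem_biUnion.2 ⟨j, Finset.mem_univ j, hi⟩)
  -- The sets `t j` need neither be disjoint nor cover the space: `F` picks some index among those
  -- that contain the point, and 0 if there is none. It errs only where some `t j` differs from its
  -- target.
  let F : (Fin k → Prop) → Fin k := fun P => if h : ∃ j, P j then h.choose else ⟨0, hk⟩
  refine ⟨M, fun x => F fun j => x ∈ t j, ?_, ?_, ?_⟩
  · have : Measurable fun x : Seq A => fun j => x ∈ t j :=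
      measurable_pi_lambda _ fun j => measurable_mem.2 (htm j)
    exact (Measurable.of_discrete (f := F)).comp this
  · intro x y hxy
    refine congrArg F (funext fun j => ?_)
    have : (s j).restrict x = (s j).restrict y := by
      funext i
      exact hxy i (hM j i i.2)
    simp only [hts j, mem_cylinder, this]
  · have hsub : {x | ξ x ≠ F fun j => x ∈ t j} ⊆ ⋃ j, symmDiff (t j) (ξ ⁻¹' {j}) := by
      intro x hx
      by_contra hcon
      have hiff : ∀ j, x ∈ t j ↔ ξ x = j := by
        intro j
        have : x ∉ symmDiff (t j) (ξ ⁻¹' {j}) := fun h => hcon (Set.mem_iUnion.2 ⟨j, h⟩)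
        rw [Set.mem_symmDiff] at this
        simp only [Set.mem_preimage, Set.mem_singleton_iff] at this
        tauto
      have hex : ∃ j, x ∈ t j := ⟨ξ x, (hiff _).2 rfl⟩
      refine hx ?_
      simp only [F, dif_pos hex]
      exact (hiff _).1 hex.choose_spec
    refine ENNReal.toReal_le_of_le_ofReal hδ.le ?_
    calc m {x | ξ x ≠ F fun j => x ∈ t j}
        ≤ m (⋃ j, symmDiff (t j) (ξ ⁻¹' {j})) := measure_mono hsub
      _ ≤ ∑ j, m (symmDiff (t j) (ξ ⁻¹' {j})) := measure_iUnion_fintype_le _ _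
      _ ≤ ∑ _j : Fin k, ENNReal.ofReal (δ / k) := Finset.sum_le_sum fun j _ => (hlt j).le
      _ = ENNReal.ofReal δ := by
        rw [Finset.sum_const, Finset.card_univ, Fintype.card_fin, nsmul_eq_mul,
          ← ENNReal.ofReal_natCast, ← ENNReal.ofReal_mul (Nat.cast_nonneg k)]
        congr 1
        field_simp

/-- The probabilities of guessing the value `j` of a partition from its approximation `ζ`. -/
def guess {X : Type*} {k : ℕ} (η : ℝ) (ζ : X → Fin k) (j : Fin k) (y : X) : ℝ :=
  if ζ y = j then 1 - η else η / k

section Guess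

variable {X : Type*} {k : ℕ} {η : ℝ} {ζ : X → Fin k}

lemma guess_pos (h0 : 0 < η) (h1 : η < 1) (j : Fin k) (y : X) : 0 < guess η ζ j y := by
  have hk : (0 : ℝ) < k := by exact_mod_cast j.pos
  rw [guess]
  split_ifs
  · linarith
  · positivity

/-- The exact total is 1 - η/k; a subprobability is all that the Gibbs inequality needs. -/
lemma sum_guess_le (h0 : 0 < η) (y : X) : ∑ j, guess η ζ j y ≤ 1 := by
  have hk : (0 : ℝ) < k := by exact_mod_cast (ζ y).pos
  have : ∀ j, guess η ζ j y ≤ (if ζ y = j then 1 - η else 0) + η / k := by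
    intro j
    rw [guess]
    have : 0 < η / k := by positivity
    split_ifs <;> linarith
  refine (Finset.sum_le_sum fun j _ => this j).trans_eq ?_
  rw [Finset.sum_add_distrib, Finset.sum_ite_eq]
  simp
  field_simp
  ring

lemma guess_le_one (h0 : 0 < η) (h1 : η < 1) (j : Fin k) (y : X) : guess η ζ j y ≤ 1 :=
  (Finset.single_le_sum (f := fun j => guess η ζ j y) (fun i _ => (guess_pos h0 h1 i y).le)
    (Finset.mem_univ j)).trans (sum_guess_le h0 y)

lemma measurable_guess [MeasurableSpace X] (hζ : Measurable ζ) (j : Fin k) :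
    Measurable (guess η ζ j) :=
  (Measurable.of_discrete (f := fun i => if i = j then 1 - η else η / k)).comp hζ

end Guess

lemma integrable_prod_guess {k : ℕ} {η : ℝ} (h0 : 0 < η) (h1 : η < 1) {ζ : Seq A → Fin k}
    (hζ : Measurable ζ) {n : ℕ} (u : Fin n → Fin k) (m : Measure (Seq A)) [IsFiniteMeasure m] :
    Integrable (fun y => ∏ i : Fin n, guess η ζ (u i) (shift^[i] y)) m := by
  have hmeas : Measurable fun y => ∏ i : Fin n, guess η ζ (u i) (shift^[i] y) :=
    Finset.measurable_prod _ fun i _ => (measurable_guess hζ _).comp (measurable_shift_iterate i)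
  refine .of_bound hmeas.aestronglyMeasurable 1 (ae_of_all _ fun y => ?_)
  rw [Real.norm_of_nonneg (Finset.prod_nonneg fun i _ => (guess_pos h0 h1 _ _).le)]
  exact Finset.prod_le_one (fun i _ => (guess_pos h0 h1 _ _).le)
    fun i _ => guess_le_one h0 h1 _ _

variable [Countable A] [MeasurableSingletonClass A]

/-- The first `n + M` letters determine `ζ` along the first `n` steps of the orbit, so the integrand
is constant on the cylinder of these letters around `x`. The left side is the integral over that
cylinder alone. -/
lemma prod_le_integral_guess {p : A → ℝ} (hp0 : ∀ a, 0 < p a) (hp1 : HasSum p 1) {k : ℕ}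
    {η : ℝ} (h0 : 0 < η) (h1 : η < 1) {ζ : Seq A → Fin k} (hζ : Measurable ζ) {M : ℕ}
    (hM : ∀ x y : Seq A, (∀ i < M, x i = y i) → ζ x = ζ y) (n : ℕ) (u : Fin n → Fin k)
    (x : Seq A) :
    (∏ i ∈ Finset.range (n + M), p (x i)) * ∏ i : Fin n, guess η ζ (u i) (shift^[i] x) ≤
      ∫ y, ∏ i : Fin n, guess η ζ (u i) (shift^[i] y) ∂productMeasure fun _ => p := by
  have hprob := isProbabilityMeasure_productMeasure (fun _ : ℕ => fun a => (hp0 a).le)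
    fun _ => hp1
  set w : Fin (n + M) → A := fun i => x i
  have hconst : ∀ y ∈ cylinder w, ∏ i : Fin n, guess η ζ (u i) (shift^[i] y) =
      ∏ i : Fin n, guess η ζ (u i) (shift^[i] x) := by
    intro y hy
    refine Finset.prod_congr rfl fun i _ => ?_
    have : ζ (shift^[i] y) = ζ (shift^[i] x) := by
      refine hM _ _ fun l hl => ?_
      rw [shift_iterate_apply, shift_iterate_apply]
      exact hy ⟨l + i, by omega⟩
    simp only [guess, this]
  have hnn : ∀ y, 0 ≤ ∏ i : Fin n, guess η ζ (u i) (shift^[i] y) := fun y =>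
    Finset.prod_nonneg fun i _ => (guess_pos h0 h1 _ _).le
  refine le_trans (le_of_eq ?_) (setIntegral_le_integral (s := cylinder w)
    (integrable_prod_guess h0 h1 hζ u _) (ae_of_all _ hnn))
  rw [setIntegral_congr_fun (measurableSet_cylinder w) hconst, setIntegral_const, smul_eq_mul,
    measureReal_def, productMeasure_cylinder (fun _ a => (hp0 a).le) (fun _ => hp1),
    ENNReal.toReal_ofReal (Finset.prod_nonneg fun i _ => (hp0 _).le), Finset.prod_range]

/-- The distribution of the `ξ`-names under `m` is compared, by the Gibbs inequality, with the names
produced by drawing a Bernoulli point and guessing `ξ` from `ζ` at each time. The cost -log q splits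
into the cost of `n + M` letters and of `n` guesses, and by invariance the terms of each kind have
equal integrals. -/
lemma refinedEntropy_le {m : Measure (Seq A)} [IsProbabilityMeasure m]
    (hm : MeasurePreserving shift m m) {p : A → ℝ} (hp0 : ∀ a, 0 < p a) (hp1 : HasSum p 1)
    (hfint : Integrable (fun x : Seq A => Real.log (p (x 0))) m) {k : ℕ} {ξ ζ : Seq A → Fin k}
    (hξ : Measurable ξ) (hζ : Measurable ζ) {M : ℕ}
    (hM : ∀ x y : Seq A, (∀ i < M, x i = y i) → ζ x = ζ y) {η : ℝ} (h0 : 0 < η) (h1 : η < 1)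
    (n : ℕ) :
    refinedEntropy m shift ξ n ≤ (n + M) * (-∫ x, Real.log (p (x 0)) ∂m) +
      n * ∫ x, -Real.log (guess η ζ (ξ x) x) ∂m := by
  have hprob := isProbabilityMeasure_productMeasure (fun _ : ℕ => fun a => (hp0 a).le)
    fun _ => hp1
  set Ξ : Seq A → Fin n → Fin k := fun x i => ξ (shift^[i] x) with hΞ
  have hΞm : Measurable Ξ := measurable_pi_lambda _ fun i =>
    hξ.comp (measurable_shift_iterate i)
  set q : (Fin n → Fin k) → ℝ := fun u =>
    ∫ y, ∏ i : Fin n, guess η ζ (u i) (shift^[i] y) ∂productMeasure fun _ => p with hq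
  obtain ⟨x₀⟩ : Nonempty (Seq A) := nonempty_of_isProbabilityMeasure m
  have hlow : ∀ (u : Fin n → Fin k) (x : Seq A), 0 < (∏ i ∈ Finset.range (n + M), p (x i)) *
      ∏ i : Fin n, guess η ζ (u i) (shift^[i] x) := fun u x =>
    mul_pos (Finset.prod_pos fun i _ => hp0 _) (Finset.prod_pos fun i _ => guess_pos h0 h1 _ _)
  have hqpos : ∀ u, 0 < q u := fun u =>
    (hlow u x₀).trans_le (prod_le_integral_guess hp0 hp1 h0 h1 hζ hM n u x₀)
  -- Summing over all names turns the sum of products into a product of sums, each at most 1.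
  have hqsum : ∑ u, q u ≤ 1 := by
    rw [hq, ← integral_finsetSum _ fun u _ => integrable_prod_guess h0 h1 hζ u _]
    have hle : ∀ y : Seq A,
        ∑ u : Fin n → Fin k, ∏ i : Fin n, guess η ζ (u i) (shift^[i] y) ≤ 1 := by
      intro y
      have h := (Fintype.prod_sum fun (i : Fin n) j => guess η ζ j (shift^[i] y)).symm
      rw [h]
      exact Finset.prod_le_one
        (fun i _ => Finset.sum_nonneg fun j _ => (guess_pos h0 h1 _ _).le)
        fun i _ => sum_guess_le h0 _
    calc ∫ y, ∑ u : Fin n → Fin k, ∏ i : Fin n, guess η ζ (u i) (shift^[i] y)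
          ∂(productMeasure fun _ => p)
        ≤ ∫ _, 1 ∂(productMeasure fun _ => p) :=
          integral_mono (integrable_finsetSum _ fun u _ => integrable_prod_guess h0 h1 hζ u _)
            (integrable_const _) hle
      _ = 1 := by simp
  have hprobΞ := Measure.isProbabilityMeasure_map (μ := m) hΞm.aemeasurable
  have hreal : ∀ u : Fin n → Fin k,
      m.real {x | ∀ i : Fin n, ξ (shift^[i] x) = u i} = (m.map Ξ).real {u} := by
    intro u
    rw [map_measureReal_apply hΞm (measurableSet_singleton u)]
    congr 1
    ext x
    simp [hΞ, funext_iff]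
  have hPsum : ∑ u, (m.map Ξ).real {u} = 1 := by
    simp
  have hstep : refinedEntropy m shift ξ n ≤ ∫ x, -Real.log (q (Ξ x)) ∂m := by
    rw [← integral_map (f := fun u => -Real.log (q u)) hΞm.aemeasurable
      (measurable_of_finite _).aestronglyMeasurable, integral_fintype .of_finite]
    simp only [refinedEntropy, hreal, smul_eq_mul]
    exact sum_negMulLog_le (fun u => measureReal_nonneg) hPsum hqpos hqsum
  have hκm : Measurable fun x : Seq A => -Real.log (guess η ζ (ξ x) x) := by
    have : Measurable fun x : Seq A => (ξ x, ζ x) := hξ.prodMk hζ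
    exact (Measurable.of_discrete (f := fun z : Fin k × Fin k =>
      -Real.log (if z.2 = z.1 then 1 - η else η / k))).comp this
  have hκi : Integrable (fun x : Seq A => -Real.log (guess η ζ (ξ x) x)) m := by
    refine .of_bound hκm.aestronglyMeasurable (|Real.log (1 - η)| + |Real.log (η / k)|)
      (ae_of_all _ fun x => ?_)
    rw [norm_neg, Real.norm_eq_abs, guess]
    split_ifs
    · exact le_add_of_nonneg_right (abs_nonneg _)
    · exact le_add_of_nonneg_left (abs_nonneg _)
  have hpi : ∀ i : ℕ, Integrable (fun x : Seq A => -Real.log (p (x i))) m := fun i => by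
    refine ((integrable_comp_shift_iterate hm i hfint).neg).congr (ae_of_all _ fun x => ?_)
    simp [shift_iterate_apply]
  have hpe : ∀ i : ℕ, ∫ x : Seq A, -Real.log (p (x i)) ∂m = -∫ x, Real.log (p (x 0)) ∂m := by
    intro i
    rw [integral_neg, ← integral_comp_shift_iterate hm i hfint.aestronglyMeasurable]
    simp [shift_iterate_apply]
  have hpoint : ∀ x, -Real.log (q (Ξ x)) ≤ ∑ i ∈ Finset.range (n + M), -Real.log (p (x i)) +
      ∑ i ∈ Finset.range n, -Real.log (guess η ζ (ξ (shift^[i] x)) (shift^[i] x)) := by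
    intro x
    have h := Real.log_le_log (hlow (Ξ x) x)
      (prod_le_integral_guess hp0 hp1 h0 h1 hζ hM n (Ξ x) x)
    rw [Real.log_mul (Finset.prod_pos fun i _ => hp0 _).ne'
      (Finset.prod_pos fun i _ => guess_pos h0 h1 _ _).ne', Real.log_prod fun i _ => (hp0 _).ne',
      Real.log_prod fun i _ => (guess_pos h0 h1 _ _).ne'] at h
    rw [Finset.sum_neg_distrib, Finset.sum_neg_distrib, Finset.sum_range (n := n)]
    linarith
  have hq_int : Integrable (fun x => -Real.log (q (Ξ x))) m := by
    have : Integrable (fun u => -Real.log (q u)) (m.map Ξ) := .of_finite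
    exact this.comp_measurable hΞm
  refine hstep.trans ?_
  refine (integral_mono hq_int ((integrable_finsetSum _ fun i _ => hpi i).add
    (integrable_finsetSum _ fun i _ => integrable_comp_shift_iterate hm i hκi)) hpoint).trans_eq ?_
  simp only [Pi.add_apply]
  rw [integral_add (integrable_finsetSum _ fun i _ => hpi i)
    (integrable_finsetSum _ fun i _ => integrable_comp_shift_iterate hm i hκi),
    integral_finsetSum _ fun i _ => hpi i,
    integral_finsetSum _ fun i _ => integrable_comp_shift_iterate hm i hκi]
  simp only [hpe]
  rw [Finset.sum_congr rfl fun i _ => integral_comp_shift_iterate hm i hκm.aestronglyMeasurable]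
  simp

/-- The entropy of an invariant measure is at most its cross entropy with a Bernoulli measure. -/
lemma ksEntropy_le {m : Measure (Seq A)} [IsProbabilityMeasure m]
    (hm : MeasurePreserving shift m m) {p : A → ℝ} (hp0 : ∀ a, 0 < p a) (hp1 : HasSum p 1)
    (hfint : Integrable (fun x : Seq A => Real.log (p (x 0))) m) :
    ksEntropy m shift ≤ ((-∫ x, Real.log (p (x 0)) ∂m : ℝ) : EReal) := by
  set C : ℝ := -∫ x, Real.log (p (x 0)) ∂m with hC
  obtain ⟨x₀⟩ : Nonempty (Seq A) := nonempty_of_isProbabilityMeasure m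
  refine iSup_le fun k => iSup_le fun ξ => iSup_le fun hξ => ?_
  have hk : (0 : ℝ) < k := by exact_mod_cast (ξ x₀).pos
  have hε : ∀ ε : ℝ, 0 < ε →
      limsup (fun n : ℕ => ((refinedEntropy m shift ξ n / n : ℝ) : EReal)) atTop ≤
        ((C + ε : ℝ) : EReal) := by
    intro ε hε
    -- With this `η` a correct guess costs exactly `ε / 2`. A wrong one costs at most `D`, and the
    -- approximation below makes wrong guesses rare enough to cost another `ε / 2` on average; the
    -- `+ 1` there keeps the denominator positive.
    set η : ℝ := 1 - Real.exp (-(ε / 2)) with hη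
    have hη0 : 0 < η := by
      have : Real.exp (-(ε / 2)) < 1 := Real.exp_lt_one_iff.2 (by linarith)
      linarith
    have hη1 : η < 1 := by
      have := Real.exp_pos (-(ε / 2))
      linarith
    set D : ℝ := |Real.log (η / k)| with hD
    obtain ⟨M, ζ, hζ, hM, hζξ⟩ := exists_cylinder_approximation m hξ
      (δ := ε / 2 / (D + 1)) (by positivity)
    have hset : MeasurableSet {x | ξ x ≠ ζ x} :=
      (measurableSet_eq_fun hξ hζ).compl
    have hκ : ∫ x, -Real.log (guess η ζ (ξ x) x) ∂m ≤ ε := by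
      have hle : ∀ x, -Real.log (guess η ζ (ξ x) x) ≤
          ε / 2 + {x | ξ x ≠ ζ x}.indicator (fun _ => D) x := by
        intro x
        rw [guess]
        by_cases h : ζ x = ξ x
        · have : x ∉ {x | ξ x ≠ ζ x} := by simp [h]
          rw [if_pos h, Set.indicator_of_notMem this, hη, sub_sub_cancel, Real.log_exp]
          linarith
        · have : x ∈ {x | ξ x ≠ ζ x} := fun h' => h h'.symm
          rw [if_neg h, Set.indicator_of_mem this]
          linarith [neg_abs_le (Real.log (η / k))]
      have hri : Integrable (fun x => ε / 2 + {x | ξ x ≠ ζ x}.indicator (fun _ => D) x) m :=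
        (integrable_const _).add ((integrable_const D).indicator hset)
      have hli : ∫ x, -Real.log (guess η ζ (ξ x) x) ∂m ≤
          ∫ x, (ε / 2 + {x | ξ x ≠ ζ x}.indicator (fun _ => D) x) ∂m :=
        integral_mono_of_nonneg (ae_of_all _ fun x => by
          simpa using Real.log_nonpos (guess_pos hη0 hη1 _ _).le (guess_le_one hη0 hη1 _ _))
          hri (ae_of_all _ hle)
      refine hli.trans ?_
      rw [integral_add (integrable_const _) ((integrable_const D).indicator hset),
        integral_indicator hset, setIntegral_const]
      have hD0 : 0 ≤ D := abs_nonneg _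
      have : m.real {x | ξ x ≠ ζ x} * D ≤ ε / 2 := by
        calc m.real {x | ξ x ≠ ζ x} * D ≤ ε / 2 / (D + 1) * (D + 1) := by
              gcongr
              linarith
          _ = ε / 2 := by field_simp
      simp only [integral_const, probReal_univ, smul_eq_mul, one_mul]
      linarith
    -- The `M` additional letters cost `M * C` in total, which disappears after division by `n`.
    have hlim : Tendsto (fun n : ℕ => C + ε + (M * C) / n) atTop (𝓝 (C + ε)) := by
      simpa using (tendsto_const_div_atTop_nhds_zero_nat (M * C)).const_add (C + ε)
    have hlimE := EReal.tendsto_coe.2 hlim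
    rw [← hlimE.limsup_eq]
    refine limsup_le_limsup (eventually_atTop.2 ⟨1, fun n hn => ?_⟩)
    rw [EReal.coe_le_coe_iff]
    have hn0 : (0 : ℝ) < n := by exact_mod_cast hn
    rw [div_le_iff₀ hn0]
    have h := refinedEntropy_le hm hp0 hp1 hfint hξ hζ hM hη0 hη1 n
    have h2 : (n : ℝ) * ∫ x, -Real.log (guess η ζ (ξ x) x) ∂m ≤ n * ε := by gcongr
    have h3 : (C + ε + M * C / n) * n = (n + M) * C + n * ε := by field_simp; ring
    rw [h3]
    linarith
  have hlim : Tendsto (fun ε : ℝ => ((C + ε : ℝ) : EReal)) (𝓝[>] 0) (𝓝 (C : EReal)) := by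
    rw [EReal.tendsto_coe]
    have : Tendsto (fun ε : ℝ => C + ε) (𝓝 0) (𝓝 (C + 0)) := tendsto_id.const_add C
    rw [add_zero] at this
    exact this.mono_left nhdsWithin_le_nhds
  exact ge_of_tendsto hlim (eventually_mem_nhdsWithin.mono fun ε hε' => hε ε hε')

end Entropy

/-! ### The entropy of Bernoulli measures -/

lemma sum_negMulLog_prod {k : ℕ} {r : Fin k → ℝ} (hr : ∑ j, r j = 1) (n : ℕ) :
    ∑ w : Fin n → Fin k, Real.negMulLog (∏ i, r (w i)) = n * ∑ j, Real.negMulLog (r j) := by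
  have hone : ∀ n : ℕ, ∑ w : Fin n → Fin k, ∏ i, r (w i) = 1 := fun n => by
    rw [← Fintype.prod_sum fun (_ : Fin n) j => r j]
    simp [hr]
  induction n with
  | zero => simp
  | succ n ih =>
    rw [← (Fin.consEquiv fun _ => Fin k).sum_comp, Fintype.sum_prod_type]
    simp only [Fin.consEquiv_apply, Fin.prod_univ_succ, Fin.cons_zero, Fin.cons_succ,
      Real.negMulLog_mul, Finset.sum_add_distrib, ← Finset.mul_sum, ← Finset.sum_mul, hone, ih,
      hr]
    push_cast
    ring

section Bernoulli

variable {A : Type*} {p : A → ℝ}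

lemma weight_le_one (hp0 : ∀ a, 0 ≤ p a) (hp1 : HasSum p 1) (a : A) : p a ≤ 1 :=
  le_hasSum hp1 a fun b _ => hp0 b

variable [MeasurableSpace A]

lemma map_eval_productMeasure (hp0 : ∀ a, 0 ≤ p a) (hp1 : HasSum p 1) (i : ℕ) :
    (productMeasure fun _ => p).map (fun x => x i) = letterMeasure p := by
  have := isProbabilityMeasure_letterMeasure hp0 hp1
  exact Measure.infinitePi_map_eval (fun _ : ℕ => letterMeasure p) i

variable [Countable A] [MeasurableSingletonClass A]

lemma refinedEntropy_letter (hp0 : ∀ a, 0 ≤ p a) (hp1 : HasSum p 1) {k : ℕ} (c : A → Fin k)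
    (n : ℕ) :
    refinedEntropy (productMeasure fun _ => p) shift (fun x => c (x 0)) n =
      n * ∑ j, Real.negMulLog ((letterMeasure p).real (c ⁻¹' {j})) := by
  have := isProbabilityMeasure_letterMeasure hp0 hp1
  have hr : ∑ j, (letterMeasure p).real (c ⁻¹' {j}) = 1 := by
    rw [sum_measureReal_preimage_singleton _ fun j _ => .of_discrete]
    simp
  rw [← sum_negMulLog_prod hr, refinedEntropy]
  refine Finset.sum_congr rfl fun w _ => ?_
  have hbox := productMeasure_box (fun _ : ℕ => hp0) (fun _ => hp1) (fun i => c ⁻¹' {w i})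
    fun i => .of_discrete
  simp only [shift_iterate_apply, zero_add]
  rw [measureReal_def]
  simp only [Set.mem_preimage, Set.mem_singleton_iff] at hbox
  rw [hbox, ENNReal.toReal_prod]
  rfl

/-- The partition separates the letters of `S` and lumps all others into one last class, whose
contribution to the entropy is nonnegative. The coded process is i.i.d., so its entropy rate is the
entropy of one step. -/
lemma sum_negMulLog_le_ksEntropy (hp0 : ∀ a, 0 ≤ p a) (hp1 : HasSum p 1) (S : Finset A) :
    ((∑ a ∈ S, Real.negMulLog (p a) : ℝ) : EReal) ≤
      ksEntropy (productMeasure fun _ => p) shift := by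
  classical
  have := isProbabilityMeasure_letterMeasure hp0 hp1
  set c : A → Fin (S.card + 1) := fun a =>
    if h : a ∈ S then (S.equivFin ⟨a, h⟩).castSucc else Fin.last _ with hc
  have hpre : ∀ j : Fin S.card, c ⁻¹' {j.castSucc} = {(S.equivFin.symm j : A)} := by
    intro j
    ext a
    simp only [hc, Set.mem_preimage, Set.mem_singleton_iff]
    split_ifs with h
    · rw [Fin.castSucc_inj, ← Equiv.eq_symm_apply, Subtype.ext_iff]
    · refine iff_of_false (Fin.castSucc_lt_last j).ne' ?_
      rintro rfl
      exact h (S.equivFin.symm j).2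
  set H : ℝ := ∑ j, Real.negMulLog ((letterMeasure p).real (c ⁻¹' {j})) with hH
  have hle : ∑ a ∈ S, Real.negMulLog (p a) ≤ H := by
    rw [hH, Fin.sum_univ_castSucc]
    refine le_add_of_le_of_nonneg (le_of_eq ?_)
      (Real.negMulLog_nonneg measureReal_nonneg measureReal_le_one)
    simp only [hpre, measureReal_def, letterMeasure_singleton, ENNReal.toReal_ofReal (hp0 _)]
    rw [S.equivFin.symm.sum_comp fun a : S => Real.negMulLog (p a), Finset.sum_coe_sort S
      fun a => Real.negMulLog (p a)]
  have hlimsup : limsup (fun n : ℕ => ((refinedEntropy (productMeasure fun _ => p) shift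
      (fun x : Seq A => c (x 0)) n / n : ℝ) : EReal)) atTop = (H : EReal) := by
    refine Tendsto.limsup_eq (tendsto_const_nhds.congr' (eventually_atTop.2 ⟨1, fun n hn => ?_⟩))
    have hn0 : (n : ℝ) ≠ 0 := by positivity
    dsimp only
    rw [refinedEntropy_letter hp0 hp1, mul_div_cancel_left₀ _ hn0]
  refine (EReal.coe_le_coe_iff.2 hle).trans ?_
  rw [← hlimsup]
  exact le_iSup_of_le _ (le_iSup_of_le _ (le_iSup_of_le
    ((Measurable.of_discrete (f := c)).comp (measurable_pi_apply 0)) le_rfl))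

/-- Since log p ≤ 0, integrability means exactly that the Shannon entropy of the weights is finite;
this separates the finite from the infinite entropy case. -/
lemma integrable_log_iff (hp0 : ∀ a, 0 ≤ p a) (hp1 : HasSum p 1) :
    Integrable (fun x : Seq A => Real.log (p (x 0))) (productMeasure fun _ => p) ↔
      Summable fun a => Real.negMulLog (p a) := by
  have hnn := fun a => Real.negMulLog_nonneg (hp0 a) (weight_le_one hp0 hp1 a)
  have hmap := integrable_map_measure (μ := productMeasure fun _ => p)
    (f := fun x : Seq A => x 0) (g := fun a => Real.log (p a))
    (Measurable.of_discrete).aestronglyMeasurable (measurable_pi_apply 0).aemeasurable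
  rw [map_eval_productMeasure hp0 hp1] at hmap
  refine hmap.symm.trans ?_
  have hterm : ∀ a, ‖Real.log (p a)‖ₑ * letterMeasure p {a} =
      ENNReal.ofReal (Real.negMulLog (p a)) := by
    intro a
    rw [letterMeasure_singleton, ← ofReal_norm, ← ENNReal.ofReal_mul (norm_nonneg _),
      Real.norm_of_nonpos (Real.log_nonpos (hp0 a) (weight_le_one hp0 hp1 a)), Real.negMulLog]
    congr 1
    ring
  have hlint : ∫⁻ a, ‖Real.log (p a)‖ₑ ∂letterMeasure p =
      ∑' a, ENNReal.ofReal (Real.negMulLog (p a)) := by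
    rw [lintegral_countable']
    exact tsum_congr hterm
  rw [Integrable, and_iff_right (Measurable.of_discrete).aestronglyMeasurable,
    hasFiniteIntegral_iff_enorm, hlint, lt_top_iff_ne_top]
  constructor
  · intro h
    refine (ENNReal.summable_toReal h).congr fun a => ?_
    rw [ENNReal.toReal_ofReal (hnn a)]
  · exact fun h => h.tsum_ofReal_ne_top

lemma ksEntropy_productMeasure_eq_top (hp0 : ∀ a, 0 ≤ p a) (hp1 : HasSum p 1)
    (h : ¬ Integrable (fun x : Seq A => Real.log (p (x 0))) (productMeasure fun _ => p)) :
    ksEntropy (productMeasure fun _ => p) shift = ⊤ := by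
  rw [integrable_log_iff hp0 hp1] at h
  by_contra hne
  -- The empty set of letters shows that the entropy is at least 0.
  have hbot : ksEntropy (productMeasure fun _ => p) shift ≠ ⊥ := fun hb => by
    have := sum_negMulLog_le_ksEntropy hp0 hp1 ∅
    rw [hb] at this
    simp at this
  lift ksEntropy (productMeasure fun _ => p) shift to ℝ using ⟨hne, hbot⟩ with K hK
  refine h (summable_of_sum_le
    (fun a => Real.negMulLog_nonneg (hp0 a) (weight_le_one hp0 hp1 a)) (c := K) fun S => ?_)
  rw [← EReal.coe_le_coe_iff, hK]
  exact sum_negMulLog_le_ksEntropy hp0 hp1 S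

/-- The cross entropy of a Bernoulli measure with itself is its Shannon entropy, which is also the
supremum of the finite partial sums. -/
lemma ksEntropy_productMeasure (hp0 : ∀ a, 0 < p a) (hp1 : HasSum p 1)
    (h : Integrable (fun x : Seq A => Real.log (p (x 0))) (productMeasure fun _ => p)) :
    ksEntropy (productMeasure fun _ => p) shift =
      ((-∫ x, Real.log (p (x 0)) ∂(productMeasure fun _ => p) : ℝ) : EReal) := by
  have hp0' := fun a => (hp0 a).le
  have hprob := isProbabilityMeasure_productMeasure (fun _ : ℕ => hp0') fun _ => hp1
  refine le_antisymm (ksEntropy_le (measurePreserving_shift_productMeasure hp0' hp1) hp0 hp1 h) ?_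
  have hsum := (integrable_log_iff hp0' hp1).1 h
  have hval : -∫ x, Real.log (p (x 0)) ∂(productMeasure fun _ => p) =
      ∑' a, Real.negMulLog (p a) := by
    have hmap := integrable_map_measure (μ := productMeasure fun _ => p)
      (f := fun x : Seq A => x 0) (g := fun a => Real.log (p a))
      (Measurable.of_discrete).aestronglyMeasurable (measurable_pi_apply 0).aemeasurable
    have hi := hmap.2 h
    have he := integral_map (μ := productMeasure fun _ => p)
      (φ := fun x : Seq A => x 0) (f := fun a => Real.log (p a))
      (measurable_pi_apply 0).aemeasurable (Measurable.of_discrete).aestronglyMeasurable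
    rw [← he, map_eval_productMeasure hp0' hp1]
    rw [map_eval_productMeasure hp0' hp1] at hi
    rw [integral_countable hi, ← tsum_neg]
    refine tsum_congr fun a => ?_
    rw [measureReal_def, letterMeasure_singleton, ENNReal.toReal_ofReal (hp0' a), smul_eq_mul,
      Real.negMulLog]
    ring
  rw [hval]
  have hlim := EReal.tendsto_coe.2 hsum.hasSum
  exact le_of_tendsto' hlim fun S => sum_negMulLog_le_ksEntropy hp0' hp1 S

end Bernoulli

/-! ### The variational principle -/

lemma extIntegral_eq {X : Type*} [MeasurableSpace X] {m : Measure X} {f : X → ℝ}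
    (hf : Integrable f m) : extIntegral m f = ((∫ x, f x ∂m : ℝ) : EReal) := by
  have h1 : ∫⁻ x, ENNReal.ofReal (f x) ∂m ≠ ⊤ := hf.lintegral_lt_top.ne
  have h2 : ∫⁻ x, ENNReal.ofReal (-f x) ∂m ≠ ⊤ := hf.neg.lintegral_lt_top.ne
  rw [extIntegral, integral_eq_lintegral_pos_part_sub_lintegral_neg_part hf, EReal.coe_sub,
    EReal.coe_ennreal_toReal h1, EReal.coe_ennreal_toReal h2]

lemma extIntegral_eq_bot {X : Type*} [MeasurableSpace X] {m : Measure X} {f : X → ℝ}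
    (hm : Measurable f) (hf : ¬ Integrable f m) (hpos : ∫⁻ x, ENNReal.ofReal (f x) ∂m ≠ ⊤) :
    extIntegral m f = ⊥ := by
  have hneg : ∫⁻ x, ENNReal.ofReal (-f x) ∂m = ⊤ := by
    by_contra hne
    refine hf ⟨hm.aestronglyMeasurable, ?_⟩
    rw [hasFiniteIntegral_iff_enorm]
    refine lt_of_le_of_lt (lintegral_mono (g := fun x => ENNReal.ofReal (f x) +
      ENNReal.ofReal (-f x)) fun x => ?_) ?_
    · dsimp only
      rw [← ofReal_norm, Real.norm_eq_abs]
      rcases le_total 0 (f x) with h | h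
      · rw [abs_of_nonneg h]
        exact le_self_add
      · rw [abs_of_nonpos h]
        exact le_add_self
    · rw [lintegral_add_left hm.ennreal_ofReal]
      exact ENNReal.add_lt_top.2 ⟨lt_top_iff_ne_top.2 hpos, lt_top_iff_ne_top.2 hne⟩
  rw [extIntegral, hneg, EReal.coe_ennreal_top, sub_eq_add_neg, EReal.neg_top, EReal.add_bot]

/-! ### Reduction of log g to a function of the first letter -/

namespace Potential

variable {A : Type*} {g : Potential A}

/-- The difference of `log g` and the function of the first letter with the same integrals. -/
def coboundary (g : Potential A) (x : Seq A) : ℝ :=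
  ∑' k, (Real.log (g.factor (k + 1) (x (k + 1))) - Real.log (g.factor (k + 1) (x 0)))

lemma abs_coboundary_term_le (hg : g.L1Bounded) (k : ℕ) (x : Seq A) :
    ‖Real.log (g.factor (k + 1) (x (k + 1))) - Real.log (g.factor (k + 1) (x 0))‖ ≤
      2 * g.logBound k := by
  refine (norm_sub_le _ _).trans ?_
  have h1 := abs_log_le_logBound hg k (x (k + 1))
  have h2 := abs_log_le_logBound hg k (x 0)
  simp only [Real.norm_eq_abs]
  linarith

lemma abs_coboundary_le (hg : g.L1Bounded) (x : Seq A) :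
    ‖g.coboundary x‖ ≤ ∑' k, 2 * g.logBound k :=
  tsum_of_norm_bounded ((summable_logBound hg).mul_left 2).hasSum
    fun k => abs_coboundary_term_le hg k x

/-- Evaluating every factor at the first letter `x 0` turns the product into `diag (x 0)`; the
bounded function `coboundary` is the error of this replacement. -/
lemma logEval_eq_add_coboundary [Nonempty A] (hg : g.L1Bounded) (hs : g.IsSummable) (x : Seq A) :
    g.logEval x = Real.log g.eigenvalue + Real.log (g.bernoulliWeight (x 0)) + g.coboundary x := by
  have hZ := tsum_diag_pos hg hs
  have h1 := (summable_log_tail hg 0 fun k => x (k + 1))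
  have h2 := (summable_log_tail hg 0 fun _ => x 0)
  have h3 := tsum_log_eq hg 0 x
  have h4 := tsum_log_eq hg 0 fun _ => x 0
  simp only [zero_add, Finset.range_one, Finset.sum_singleton] at h1 h2 h3 h4
  rw [logEval_eq hg, eigenvalue, Real.log_mul g.const_pos.ne' hZ.ne', bernoulliWeight,
    Real.log_div (diag_pos hg _).ne' hZ.ne', diag_eq hg, Real.log_exp, coboundary,
    h1.tsum_sub h2, h3, h4]
  ring

lemma log_bernoulliWeight_nonpos [Nonempty A] (hg : g.L1Bounded) (hs : g.IsSummable) (a : A) :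
    Real.log (g.bernoulliWeight a) ≤ 0 :=
  Real.log_nonpos (bernoulliWeight_pos hg hs a).le
    (weight_le_one (fun a => (bernoulliWeight_pos hg hs a).le) (hasSum_bernoulliWeight hg hs) a)

/-- In the decomposition the only unbounded term is the logarithm of a probability weight, which is
nonpositive, so log g is bounded above. -/
lemma lintegral_logEval_ne_top [MeasurableSpace A] [Nonempty A] (hg : g.L1Bounded) (hs : g.IsSummable)
    (m : Measure (Seq A)) [IsProbabilityMeasure m] : ∫⁻ x, ENNReal.ofReal (g.logEval x) ∂m ≠ ⊤ := by
  refine ne_top_of_le_ne_top (ENNReal.ofReal_ne_top (r := Real.log g.eigenvalue +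
    ∑' k, 2 * g.logBound k)) ?_
  refine (lintegral_mono fun x => ENNReal.ofReal_le_ofReal (q := Real.log g.eigenvalue +
    ∑' k, 2 * g.logBound k) ?_).trans_eq (by simp)
  rw [logEval_eq_add_coboundary hg hs]
  have h1 := log_bernoulliWeight_nonpos hg hs (x 0)
  have h2 := (le_abs_self _).trans (abs_coboundary_le hg x)
  linarith

variable [MeasurableSpace A] [DiscreteMeasurableSpace A]

lemma measurable_log_factor (k i : ℕ) :
    Measurable fun x : Seq A => Real.log (g.factor k (x i)) :=
  (Measurable.of_discrete (f := fun a => Real.log (g.factor k a))).comp (measurable_pi_apply i)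

lemma integrable_coboundary (hg : g.L1Bounded) (m : Measure (Seq A)) [IsFiniteMeasure m] :
    Integrable g.coboundary m :=
  .of_bound (Measurable.tsum fun k => (measurable_log_factor (k + 1) (k + 1)).sub
    (measurable_log_factor (k + 1) 0)).aestronglyMeasurable _ (ae_of_all _ (abs_coboundary_le hg))

/-- Each term has the form f∘T^{k+1} - f with bounded f, so its integral is 0; ℓ₁-boundedness allows
integration term by term. -/
lemma integral_coboundary (hg : g.L1Bounded) {m : Measure (Seq A)} [IsProbabilityMeasure m]
    (hm : MeasurePreserving shift m m) : ∫ x, g.coboundary x ∂m = 0 := by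
  have hbd : ∀ k i : ℕ, Integrable (fun x : Seq A => Real.log (g.factor (k + 1) (x i))) m :=
    fun k i => .of_bound (measurable_log_factor _ _).aestronglyMeasurable (g.logBound k)
      (ae_of_all _ fun x => abs_log_le_logBound hg k _)
  simp only [coboundary]
  rw [← integral_tsum_of_summable_integral_norm (F := fun k (x : Seq A) =>
    Real.log (g.factor (k + 1) (x (k + 1))) - Real.log (g.factor (k + 1) (x 0)))
    fun k => (hbd k (k + 1)).sub (hbd k 0)]
  · refine (tsum_congr fun k => ?_).trans tsum_zero
    rw [integral_sub (hbd k (k + 1)) (hbd k 0),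
      ← integral_comp_shift_iterate hm (k + 1) (hbd k 0).aestronglyMeasurable]
    simp [shift_iterate_apply]
  · refine .of_nonneg_of_le (fun k => integral_nonneg fun _ => norm_nonneg _) (fun k => ?_)
      ((summable_logBound hg).mul_left 2)
    refine (integral_mono ((hbd k (k + 1)).sub (hbd k 0)).norm
      (integrable_const (2 * g.logBound k)) fun x => abs_coboundary_term_le hg k x).trans_eq ?_
    simp

variable [Nonempty A]

lemma integrable_logEval_iff (hg : g.L1Bounded) (hs : g.IsSummable) (m : Measure (Seq A))
    [IsFiniteMeasure m] :
    Integrable g.logEval m ↔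
      Integrable (fun x : Seq A => Real.log (g.bernoulliWeight (x 0))) m := by
  rw [funext (logEval_eq_add_coboundary hg hs)]
  constructor
  · intro h
    refine ((h.sub (integrable_coboundary hg m)).sub
      (integrable_const (Real.log g.eigenvalue))).congr (ae_of_all _ fun x => ?_)
    simp only [Pi.sub_apply]
    ring
  · intro h
    exact ((integrable_const _).add h).add (integrable_coboundary hg m)

lemma integral_logEval (hg : g.L1Bounded) (hs : g.IsSummable) {m : Measure (Seq A)}
    [IsProbabilityMeasure m] (hm : MeasurePreserving shift m m)
    (hfint : Integrable (fun x : Seq A => Real.log (g.bernoulliWeight (x 0))) m) :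
    ∫ x, g.logEval x ∂m =
      Real.log g.eigenvalue + ∫ x, Real.log (g.bernoulliWeight (x 0)) ∂m := by
  simp only [logEval_eq_add_coboundary hg hs]
  have h : Integrable (fun x : Seq A => Real.log g.eigenvalue +
      Real.log (g.bernoulliWeight (x 0))) m := (integrable_const _).add hfint
  rw [integral_add h (integrable_coboundary hg m),
    integral_add (integrable_const _) hfint, integral_coboundary hg hm]
  simp

variable [Countable A]

lemma ksEntropy_bernoulliMeasure_eq_top (hg : g.L1Bounded) (hs : g.IsSummable)
    (h : ¬ Integrable g.logEval g.bernoulliMeasure) :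
    ksEntropy g.bernoulliMeasure shift = ⊤ := by
  have hprob := isProbabilityMeasure_bernoulliMeasure hg hs
  rw [integrable_logEval_iff hg hs] at h
  exact ksEntropy_productMeasure_eq_top (fun a => (bernoulliWeight_pos hg hs a).le)
    (hasSum_bernoulliWeight hg hs) h

lemma ksEntropy_bernoulliMeasure (hg : g.L1Bounded) (hs : g.IsSummable)
    (h : Integrable g.logEval g.bernoulliMeasure) :
    ksEntropy g.bernoulliMeasure shift =
      ((Real.log g.eigenvalue - ∫ x, g.logEval x ∂g.bernoulliMeasure : ℝ) : EReal) := by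
  have hprob := isProbabilityMeasure_bernoulliMeasure hg hs
  rw [integrable_logEval_iff hg hs] at h
  rw [integral_logEval hg hs (bernoulliMeasure_mem_invariantMeasures hg hs).2 h,
    sub_add_cancel_left]
  exact ksEntropy_productMeasure (bernoulliWeight_pos hg hs) (hasSum_bernoulliWeight hg hs) h

lemma ksEntropy_bernoulliMeasure_eq_sub (hg : g.L1Bounded) (hs : g.IsSummable) :
    ksEntropy g.bernoulliMeasure shift =
      (Real.log g.eigenvalue : EReal) - extIntegral g.bernoulliMeasure g.logEval := by
  have hprob := isProbabilityMeasure_bernoulliMeasure hg hs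
  by_cases h : Integrable g.logEval g.bernoulliMeasure
  · rw [extIntegral_eq h, ksEntropy_bernoulliMeasure hg hs h, EReal.coe_sub]
  · rw [extIntegral_eq_bot (measurable_logEval hg) h (lintegral_logEval_ne_top hg hs _),
      ksEntropy_bernoulliMeasure_eq_top hg hs h, EReal.coe_sub_bot]

lemma ksEntropy_add_integral (hg : g.L1Bounded) (hs : g.IsSummable)
    (h : Integrable g.logEval g.bernoulliMeasure) :
    ksEntropy g.bernoulliMeasure shift + ((∫ x, g.logEval x ∂g.bernoulliMeasure : ℝ) : EReal) =
      (Real.log g.eigenvalue : ℝ) := by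
  rw [ksEntropy_bernoulliMeasure hg hs h, ← EReal.coe_add, sub_add_cancel]

lemma integrable_logEval_of_finite [Finite A] (hg : g.L1Bounded) (hs : g.IsSummable)
    (m : Measure (Seq A)) [IsFiniteMeasure m] : Integrable g.logEval m := by
  rw [integrable_logEval_iff hg hs]
  have h : Integrable (fun a => Real.log (g.bernoulliWeight a)) (m.map fun x => x 0) := .of_finite
  exact h.comp_measurable (measurable_pi_apply 0)

/-- For any invariant `m`, the integral of log g is log λ minus the cross entropy of `m` with μ̃,
which dominates the entropy of `m`. Thus log λ bounds the supremum, and μ̃ attains it. -/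
lemma isEquilibriumState_bernoulliMeasure [Finite A] (hg : g.L1Bounded) (hs : g.IsSummable) :
    IsEquilibriumState g.logEval g.bernoulliMeasure := by
  have hmem := bernoulliMeasure_mem_invariantMeasures hg hs
  have hprob := hmem.1
  refine ⟨hmem, ⟨_, hmem, rfl⟩, ?_⟩
  rintro _ ⟨m, ⟨hm1, hm2⟩, rfl⟩
  have hi := (integrable_logEval_iff hg hs m).1 (integrable_logEval_of_finite hg hs m)
  rw [ksEntropy_add_integral hg hs (integrable_logEval_of_finite hg hs _)]
  refine (add_le_add_left (ksEntropy_le hm2 (bernoulliWeight_pos hg hs)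
    (hasSum_bernoulliWeight hg hs) hi) _).trans_eq ?_
  rw [← EReal.coe_add, integral_logEval hg hs hm2 hi]
  congr 1
  ring

end Potential

/-! ### The eigenfunction -/

open ProbabilityTheory in
/-- A series of independent centred random variables with summable variances converges almost
surely. -/
lemma ae_exists_tendsto_sum_of_iIndepFun {Ω : Type*} [MeasurableSpace Ω] {μ : Measure Ω}
    [IsProbabilityMeasure μ] {X : ℕ → Ω → ℝ} (hm : ∀ i, Measurable (X i))
    (h2 : ∀ i, MemLp (X i) 2 μ) (hind : iIndepFun X μ) (h0 : ∀ i, ∫ ω, X i ω ∂μ = 0)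
    (hs : Summable fun i => ∫ ω, X i ω ^ 2 ∂μ) :
    ∀ᵐ ω ∂μ, ∃ c, Tendsto (fun n => ∑ i ∈ Finset.range n, X i ω) atTop (𝓝 c) := by
  have hsm : ∀ i, StronglyMeasurable (X i) := fun i => (hm i).stronglyMeasurable
  set ℱ := Filtration.natural X hsm with hℱ
  -- The sum includes the index `n`, which makes `f n` measurable for the `n`-th σ-algebra of the
  -- natural filtration.
  set f : ℕ → Ω → ℝ := fun n => ∑ i ∈ Finset.range (n + 1), X i with hf
  have hXi : ∀ i, Integrable (X i) μ := fun i => (h2 i).integrable one_le_two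
  have hf2 : ∀ n, MemLp (f n) 2 μ := fun n => memLp_finsetSum' _ fun i _ => h2 i
  have hfi : ∀ n, Integrable (f n) μ := fun n => (hf2 n).integrable one_le_two
  have hadp : StronglyAdapted ℱ f := fun n =>
    Finset.stronglyMeasurable_sum _ fun i hi =>
      (Filtration.stronglyAdapted_natural hsm i).mono
        (ℱ.mono (Nat.lt_succ_iff.1 (Finset.mem_range.1 hi)))
  have hmart : Martingale f ℱ μ := by
    refine martingale_of_condExp_sub_eq_zero_nat hadp hfi fun n => ?_
    have hdiff : f (n + 1) - f n = X (n + 1) := by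
      simp only [hf, Finset.sum_range_succ _ (n + 1), add_sub_cancel_left]
    rw [hdiff]
    refine (hind.condExp_natural_ae_eq_of_lt hsm n.lt_succ_self).trans (ae_of_all _ fun ω => ?_)
    simp [h0]
  have hf0 : ∀ n, ∫ ω, f n ω ∂μ = 0 := fun n => by
    simp only [hf, Finset.sum_apply]
    rw [integral_finsetSum _ fun i _ => hXi i]
    simp [h0]
  have hvar : ∀ n, ∫ ω, f n ω ^ 2 ∂μ ≤ ∑' i, ∫ ω, X i ω ^ 2 ∂μ := by
    intro n
    rw [← variance_of_integral_eq_zero (hfi n).aemeasurable (hf0 n), hf,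
      IndepFun.variance_sum (fun i _ => h2 i) fun i _ j _ hij => hind.indepFun hij]
    rw [Finset.sum_congr rfl fun i _ => variance_of_integral_eq_zero (hXi i).aemeasurable (h0 i)]
    exact hs.sum_le_tsum _ fun i _ => integral_nonneg fun _ => sq_nonneg _
  -- The L¹ bound needed for martingale convergence comes from the variances through |t| ≤ 1 + t².
  have hbdd : ∀ n, eLpNorm (f n) 1 μ ≤
      (Real.toNNReal (1 + ∑' i, ∫ ω, X i ω ^ 2 ∂μ) : ℝ≥0∞) := by
    intro n
    rw [eLpNorm_one_eq_lintegral_enorm, ← ofReal_integral_norm_eq_lintegral_enorm (hfi n)]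
    refine ENNReal.ofReal_le_ofReal ?_
    have hi : Integrable (fun ω => 1 + f n ω ^ 2) μ := (integrable_const 1).add (hf2 n).integrable_sq
    calc ∫ ω, ‖f n ω‖ ∂μ ≤ ∫ ω, (1 + f n ω ^ 2) ∂μ := by
          refine integral_mono (hfi n).norm hi fun ω => ?_
          dsimp only
          rw [Real.norm_eq_abs, ← sq_abs]
          nlinarith [sq_nonneg (|f n ω| - 1), abs_nonneg (f n ω)]
      _ = 1 + ∫ ω, f n ω ^ 2 ∂μ := by
          rw [integral_add (integrable_const 1) (hf2 n).integrable_sq]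
          simp
      _ ≤ _ := by gcongr; exact hvar n
  filter_upwards [hmart.submartingale.ae_tendsto_limitProcess hbdd] with ω hω
  refine ⟨_, (tendsto_add_atTop_iff_nat 1).1 (hω.congr fun n => ?_)⟩
  simp [hf]

namespace Potential

variable {A : Type*} {g : Potential A}

lemma summable_log_eigenFactor (hg : g.L1Bounded) (i : ℕ) (a : A) :
    Summable fun k => Real.log (g.factor (i + 1 + k) a) := by
  refine (summable_log_tail hg i fun _ => a).congr fun k => ?_
  rw [show i + 1 + k = i + k + 1 by ring]

lemma log_eigenFactor (hg : g.L1Bounded) (i : ℕ) (a : A) :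
    Real.log (g.eigenFactor i a) = ∑' k, Real.log (g.factor (i + 1 + k) a) := by
  rw [eigenFactor_eq hg, Real.log_exp]

lemma eigenFactor_eq_mul (hg : g.L1Bounded) (i : ℕ) (a : A) :
    g.eigenFactor i a = g.factor (i + 1) a * g.eigenFactor (i + 1) a := by
  rw [eigenFactor_eq hg, eigenFactor_eq hg, (summable_log_eigenFactor hg i a).tsum_eq_zero_add,
    Real.exp_add, add_zero, Real.exp_log (g.factor_pos _ _)]
  congr 3
  funext k
  rw [show i + 1 + (k + 1) = i + 1 + 1 + k by ring]

lemma diag_eq_mul_eigenFactor (hg : g.L1Bounded) (a : A) :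
    g.diag a = g.factor 0 a * g.eigenFactor 0 a := by
  rw [diag_eq hg, eigenFactor_eq hg, (summable_log hg fun _ => a).tsum_eq_zero_add, Real.exp_add,
    Real.exp_log (g.factor_pos _ _)]
  congr 3
  funext k
  rw [zero_add, add_comm]

lemma eval_cons (hg : g.L1Bounded) (a : A) (x : Seq A) :
    g.eval (cons a x) =
      g.const * (g.factor 0 a * Real.exp (∑' k, Real.log (g.factor (k + 1) (x k)))) := by
  rw [eval_eq hg, (summable_log hg (cons a x)).tsum_eq_zero_add, Real.exp_add, cons_zero,
    Real.exp_log (g.factor_pos _ _)]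
  rfl

/-- Prepending a letter moves `x i` from `eigenFactor i` to `eigenFactor (i + 1)`, which divides the
product by the factors `g.factor (i + 1) (x i)`. Their product converges absolutely, so even
conditional convergence is inherited. -/
lemma EigenfunctionHasValue.cons (hg : g.L1Bounded) {x : Seq A} {c : ℝ}
    (h : g.EigenfunctionHasValue x c) (a : A) :
    g.EigenfunctionHasValue (cons a x)
      (g.eigenFactor 0 a * (c / Real.exp (∑' k, Real.log (g.factor (k + 1) (x k))))) := by
  refine ⟨mul_pos (eigenFactor_pos hg 0 a) (div_pos h.1 (Real.exp_pos _)), ?_⟩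
  rw [← tendsto_add_atTop_iff_nat 1]
  have hsum : Summable fun k => Real.log (g.factor (k + 1) (x k)) := by
    simpa using summable_log_tail hg 0 x
  have hexp := (Real.continuous_exp.tendsto _).comp hsum.hasSum.tendsto_sum_nat
  refine ((h.2.div hexp (Real.exp_ne_zero _)).const_mul _).congr fun N => ?_
  rw [Finset.prod_range_succ', mul_comm]
  simp only [cons_succ, cons_zero, Function.comp_apply, Pi.div_apply]
  rw [Real.exp_sum, ← Finset.prod_div_distrib]
  congr 1
  refine Finset.prod_congr rfl fun i _ => ?_
  rw [Real.exp_log (g.factor_pos _ _), eigenFactor_eq_mul hg i,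
    mul_div_cancel_left₀ _ (g.factor_pos _ _).ne']

lemma EigenfunctionHasValue.eigenfunction_eq {x : Seq A} {c : ℝ}
    (h : g.EigenfunctionHasValue x c) : g.eigenfunction x = c :=
  h.2.limUnder_eq

lemma EigenfunctionExistsAt.of_shift (hg : g.L1Bounded) {y : Seq A}
    (h : g.EigenfunctionExistsAt (shift y)) : g.EigenfunctionExistsAt y := by
  obtain ⟨c, hc⟩ := h
  have := hc.cons hg (y 0)
  rw [cons_shift] at this
  exact ⟨_, this⟩

/-- The product over the letters of `x` in g(ax) cancels the denominator of h(ax), so the branch `a`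
contributes `g.const * g.diag a` times h(x). -/
lemma ruelle_eigenfunction (hg : g.L1Bounded) {x : Seq A} (h : g.EigenfunctionExistsAt x) :
    ruelle g.logEval g.eigenfunction x = g.eigenvalue * g.eigenfunction x := by
  obtain ⟨c, hc⟩ := h
  rw [ruelle_eq, hc.eigenfunction_eq, eigenvalue, mul_right_comm, ← tsum_mul_left]
  refine tsum_congr fun a => ?_
  rw [(hc.cons hg a).eigenfunction_eq, exp_logEval hg, eval_cons hg, diag_eq_mul_eigenFactor hg]
  have := Real.exp_ne_zero (∑' k, Real.log (g.factor (k + 1) (x k)))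
  field_simp

section Uniform

variable [Fintype A]

/-- The balanced form makes the uniform mean of each logarithm vanish, so the random series is
centred. -/
lemma sum_log_eigenFactor (hg : g.L1Bounded) (hb : g.Balanced) (i : ℕ) :
    ∑ a, Real.log (g.eigenFactor i a) = 0 := by
  simp only [log_eigenFactor hg]
  rw [← Summable.tsum_finsetSum fun a _ => summable_log_eigenFactor hg i a]
  refine (tsum_congr fun k => ?_).trans tsum_zero
  rw [← Real.log_prod fun a _ => (g.factor_pos _ _).ne', hb, Real.log_one]

variable [Nonempty A]

lemma hasSum_uniform : HasSum (fun _ : A => 1 / (Fintype.card A : ℝ)) 1 := by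
  have h := hasSum_fintype fun _ : A => 1 / (Fintype.card A : ℝ)
  simpa using h

variable [MeasurableSpace A] [MeasurableSingletonClass A]

lemma integral_uniformBernoulli (f : A → ℝ) (i : ℕ) :
    ∫ x, f (x i) ∂(uniformBernoulli A) = (1 / (Fintype.card A : ℝ)) * ∑ a, f a := by
  have h0 : ∀ _ : A, 0 ≤ 1 / (Fintype.card A : ℝ) := fun _ => by positivity
  have := isProbabilityMeasure_letterMeasure h0 hasSum_uniform
  rw [uniformBernoulli, ← integral_map (φ := fun x : Seq A => x i)
    (measurable_pi_apply i).aemeasurable (Measurable.of_discrete).aestronglyMeasurable,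
    map_eval_productMeasure h0 hasSum_uniform, integral_fintype .of_finite, Finset.mul_sum]
  refine Finset.sum_congr rfl fun a _ => ?_
  rw [measureReal_def, letterMeasure_singleton, ENNReal.toReal_ofReal (h0 a), smul_eq_mul]

lemma summable_integral_log_eigenFactor_sq (hg : g.L1Bounded) (h2 : g.L2BoundedTails) :
    Summable fun i =>
      ∫ x, Real.log (g.eigenFactor i (x i)) ^ 2 ∂(uniformBernoulli A) := by
  obtain ⟨k, hk⟩ := h2
  obtain ⟨v, hv⟩ : ∃ v : ℕ → ℝ≥0∞, v = fun i => ⨆ a : A,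
    ENNReal.ofReal ((∑' j : ℕ, Real.log (g.factor (k + i + j) a)) ^ 2) := ⟨_, rfl⟩
  have hvfin : ∑' i, v i ≠ ∞ := by
    rw [hv]
    exact hk.ne
  -- The shift by one is needed because `eigenFactor (i + k)` starts with the factor of index `k +
  -- (i + 1)`.
  have hvs : Summable fun i => (v (i + 1)).toReal :=
    (summable_nat_add_iff 1).2 (ENNReal.summable_toReal hvfin)
  rw [← summable_nat_add_iff k]
  refine .of_nonneg_of_le (fun i => integral_nonneg fun x => sq_nonneg _) (fun i => ?_) hvs
  have hle : ∀ a, Real.log (g.eigenFactor (i + k) a) ^ 2 ≤ (v (i + 1)).toReal := by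
    intro a
    rw [log_eigenFactor hg]
    have hle : ENNReal.ofReal ((∑' j : ℕ, Real.log (g.factor (k + (i + 1) + j) a)) ^ 2) ≤
        v (i + 1) := by
      rw [hv]
      exact le_iSup (fun a : A => ENNReal.ofReal
        ((∑' j : ℕ, Real.log (g.factor (k + (i + 1) + j) a)) ^ 2)) a
    have h := ENNReal.toReal_mono (ENNReal.ne_top_of_tsum_ne_top hvfin (i + 1)) hle
    rw [ENNReal.toReal_ofReal (sq_nonneg _)] at h
    rwa [show i + k + 1 = k + (i + 1) by ring]
  rw [integral_uniformBernoulli fun a => Real.log (g.eigenFactor (i + k) a) ^ 2]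
  calc 1 / (Fintype.card A : ℝ) * ∑ a, Real.log (g.eigenFactor (i + k) a) ^ 2
      ≤ 1 / (Fintype.card A : ℝ) * ∑ _a : A, (v (i + 1)).toReal := by
        gcongr with a
        exact hle a
    _ = (v (i + 1)).toReal := by simp

lemma ae_eigenfunctionExistsAt (hg : g.L1Bounded) (hb : g.Balanced) (h2 : g.L2BoundedTails) :
    ∀ᵐ x ∂(uniformBernoulli A), g.EigenfunctionExistsAt x := by
  have h0 : ∀ _ : A, 0 ≤ 1 / (Fintype.card A : ℝ) := fun _ => by positivity
  have := isProbabilityMeasure_letterMeasure h0 hasSum_uniform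
  have hprob : IsProbabilityMeasure (uniformBernoulli A) :=
    isProbabilityMeasure_productMeasure (fun _ => h0) fun _ => hasSum_uniform
  have hm : ∀ i, Measurable fun x : Seq A => Real.log (g.eigenFactor i (x i)) := fun i =>
    (Measurable.of_discrete (f := fun a => Real.log (g.eigenFactor i a))).comp
      (measurable_pi_apply i)
  have hconv := ae_exists_tendsto_sum_of_iIndepFun (μ := uniformBernoulli A) hm
    (fun i => .of_bound (hm i).aestronglyMeasurable (∑ a, |Real.log (g.eigenFactor i a)|)
      (ae_of_all _ fun x => Finset.single_le_sum (f := fun a => |Real.log (g.eigenFactor i a)|)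
        (fun a _ => abs_nonneg _) (Finset.mem_univ (x i))))
    (ProbabilityTheory.iIndepFun_infinitePi (X := fun i a => Real.log (g.eigenFactor i a))
      fun i => .of_discrete)
    (fun i => by
      rw [integral_uniformBernoulli fun a => Real.log (g.eigenFactor i a),
        sum_log_eigenFactor hg hb, mul_zero])
    (summable_integral_log_eigenFactor_sq hg h2)
  filter_upwards [hconv] with x hx
  obtain ⟨c, hc⟩ := hx
  refine ⟨Real.exp c, Real.exp_pos c, ((Real.continuous_exp.tendsto c).comp hc).congr fun N => ?_⟩
  rw [Function.comp_apply, Real.exp_sum]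
  exact Finset.prod_congr rfl fun i _ => Real.exp_log (eigenFactor_pos hg i _)

end Uniform

end Potential

end ProductType

end

theorem theorem4p2 {A : Type*} [Countable A] [Nonempty A] [TopologicalSpace A]
    [DiscreteTopology A] [MeasurableSpace A] [BorelSpace A]
    (g : ProductType.Potential A) (hg₁ : g.L1Bounded) (hgs : g.IsSummable) :
    -- `μ` and `μ̃` are probability measures, and `μ̃` is shift invariant
    (MeasureTheory.IsProbabilityMeasure g.conformalMeasure ∧
      g.bernoulliMeasure ∈ ProductType.invariantMeasures A) ∧
    -- `L_{log g}^* μ = λ μ`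
    ProductType.IsDualImage g.logEval g.conformalMeasure
      (ENNReal.ofReal g.eigenvalue • g.conformalMeasure) ∧
    -- `L_{log g̃}^* μ̃ = μ̃`
    ProductType.IsDualImage g.logNormalized g.bernoulliMeasure g.bernoulliMeasure ∧
    -- `0 < λ` and `P(log g) = log λ`
    (0 < g.eigenvalue ∧ ProductType.HasPressure g.logEval (Real.log g.eigenvalue : ℝ)) ∧
    -- `∫ log g dμ̃` exists in `[-∞, ∞)`, and `h_{μ̃}(T) = log λ - ∫ log g dμ̃` in `[0, ∞]`
    (∫⁻ x, ENNReal.ofReal (g.logEval x) ∂g.bernoulliMeasure ≠ ⊤ ∧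
      ProductType.ksEntropy g.bernoulliMeasure ProductType.shift =
        (Real.log g.eigenvalue : EReal) -
          ProductType.extIntegral g.bernoulliMeasure g.logEval) ∧
    -- hence `P(log g) = h_{μ̃}(T) + ∫ log g dμ̃`, unless the right-hand side reads `∞ - ∞`
    (ProductType.ksEntropy g.bernoulliMeasure ProductType.shift ≠ ⊤ →
      MeasureTheory.Integrable g.logEval g.bernoulliMeasure ∧
      ProductType.HasPressure g.logEval
        (ProductType.ksEntropy g.bernoulliMeasure ProductType.shift +
          ((∫ x, g.logEval x ∂g.bernoulliMeasure : ℝ) : EReal))) ∧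
    -- for a finite alphabet the entropy is finite and `μ̃` is an equilibrium state
    (Finite A →
      ProductType.ksEntropy g.bernoulliMeasure ProductType.shift ≠ ⊤ ∧
      ProductType.IsEquilibriumState g.logEval g.bernoulliMeasure) ∧
    -- the eigenfunction, for a finite alphabet
    (∀ [Fintype A], g.Balanced → g.L2BoundedTails →
      (∀ᵐ x ∂(ProductType.uniformBernoulli A), g.EigenfunctionExistsAt x) ∧
      ∀ x, g.EigenfunctionExistsAt x →
        (∀ y, ProductType.shift y = x → g.EigenfunctionExistsAt y) ∧
        ProductType.ruelle g.logEval g.eigenfunction x = g.eigenvalue * g.eigenfunction x) := by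
  have hprob := ProductType.Potential.isProbabilityMeasure_bernoulliMeasure hg₁ hgs
  refine ⟨⟨ProductType.Potential.isProbabilityMeasure_conformalMeasure hg₁ hgs,
      ProductType.Potential.bernoulliMeasure_mem_invariantMeasures hg₁ hgs⟩,
    ProductType.Potential.isDualImage_logEval hg₁ hgs,
    ProductType.Potential.isDualImage_logNormalized hg₁ hgs,
    ⟨ProductType.Potential.eigenvalue_pos hg₁ hgs,
      ProductType.Potential.hasPressure_logEval hg₁ hgs⟩,
    ⟨ProductType.Potential.lintegral_logEval_ne_top hg₁ hgs _,
      ProductType.Potential.ksEntropy_bernoulliMeasure_eq_sub hg₁ hgs⟩, ?_, ?_, ?_⟩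
  · intro htop
    have hfint : MeasureTheory.Integrable g.logEval g.bernoulliMeasure := by
      by_contra h
      exact htop (ProductType.Potential.ksEntropy_bernoulliMeasure_eq_top hg₁ hgs h)
    refine ⟨hfint, ?_⟩
    rw [ProductType.Potential.ksEntropy_add_integral hg₁ hgs hfint]
    exact ProductType.Potential.hasPressure_logEval hg₁ hgs
  · intro _
    refine ⟨?_, ProductType.Potential.isEquilibriumState_bernoulliMeasure hg₁ hgs⟩
    rw [ProductType.Potential.ksEntropy_bernoulliMeasure hg₁ hgs
      (ProductType.Potential.integrable_logEval_of_finite hg₁ hgs _)]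
    exact EReal.coe_ne_top _
  · intro _ hb h2
    refine ⟨ProductType.Potential.ae_eigenfunctionExistsAt hg₁ hb h2, fun x hx => ⟨?_,
      ProductType.Potential.ruelle_eigenfunction hg₁ hx⟩⟩
    rintro y rfl
    exact hx.of_shift hg₁
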